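/- Let $\Omega$ be a Hausdorff space with Borel $\sigma$-field $\mathfrak B$, let $\Theta$ be the set of all measures $\mu$ on $\mathfrak B$ with $\mu(\Omega)<\infty$, and let $\kappa_1,\kappa_2,\dots$ be independent realizations of the Poisson random process with (unknown) mean measure $\mu\in\Theta$; $P_\mu$, $E_\mu$ denote the corresponding probability and expectation. For $\Theta_0,\Theta_1\subset\Theta$ one tests $H_0:\mu\in\Theta_0$ against $H_1:\mu\in\Theta_1$. A test $K_n=K_n(\kappa_1,\dots,\kappa_n)$ is a measurable function with values in $[0,1]$ (the probability of rejecting $H_0$), $\alpha(K_n)=\sup_{\mu\in\Theta_0}E_\mu K_n$ and $\beta(K_n)=\sup_{\mu\in\Theta_1}E_\mu(1-K_n)$, where a supremum over the empty set is $0$. Definitions. $\Theta_0,\Theta_1$ are *distinguishable* if for every $a\in(0,1)$ there are tests $K_n$ with $\alpha(K_n)<a$ for all $n$ and $\beta(K_n)\to0$; they are *indistinguishable* if $\alpha(K_n)+\beta(K_n)\ge1$ for every $n$ and every test $K_n$. A sequence of $\{0,1\}$-valued tests $K_n$ *uniformly discerns* $\Theta_0$ and $\Theta_1$ if there is a positive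 random variable $N$ (a measurable function of $\kappa_1,\kappa_2,\dots$) with $\lim_{C\to\infty}\sup_{\mu\in\Theta_0\cup\Theta_1}P_\mu(N>C)=0$, $P_\mu(K_n=0\text{ for all }n>N)=1$ for all $\mu\in\Theta_0$ and $P_\mu(K_n=1\text{ for all }n>N)=1$ for all $\mu\in\Theta_1$; if such tests exist, $\Theta_0,\Theta_1$ are *uniformly discernible*. The $\tau$-topology on $\Theta$ is the coarsest one making $\mu\mapsto\mu(B)$ continuous for all $B\in\mathfrak B$; the weak topology is the coarsest one making $\mu\mapsto\int f\,d\mu$ continuous for all bounded continuous $f:\Omega\to\mathbb R$, and $\mathrm{cl}_c$ denotes closure in the weak topology. A set is relatively compact in a topology if its closure in it is compact. $\Theta_0$ is *uniformly asymptotically discernible* if there are sets $\Theta_k'\subset\Theta'_{k+1}\subset\Theta$, $k=1,2,\dots$, with $\bigcup_k\Theta_k'\cup\mathrm{cl}_c(\Theta_0)=\Theta$ and one sequence of tests $K_n$ that, for every $k$, uniformly discerns $\Theta_0$ and $\Theta_k'$. Theorem. (a) Let $\Omega$ be Polish. (i) If $\Theta_0$ and $\Theta_1$ are relatively compact in the $\tau$-topology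 and $\mathrm{cl}_c(\Theta_0)\cap\mathrm{cl}_c(\Theta_1)\neq\emptyset$, then $\Theta_0,\Theta_1$ are indistinguishable. (ii) If $\Theta_0$ or $\Theta_1$ is relatively compact in the weak topology and $\mathrm{cl}_c(\Theta_0)\cap\mathrm{cl}_c(\Theta_1)=\emptyset$, then $\Theta_0,\Theta_1$ are distinguishable; moreover there are tests $K_n$, a constant $c>0$ and $n_0$ such that $\alpha(K_n)\le e^{-cn}$ and $\beta(K_n)\le e^{-cn}$ for all $n>n_0$. (b) Let $\Omega$ be Polish. If $\Theta_0$ or $\Theta_1$ is relatively compact in the weak topology and $\mathrm{cl}_c(\Theta_0)\cap\mathrm{cl}_c(\Theta_1)=\emptyset$, then there are open sets $B_1,\dots,B_k\subset\Omega$ such that the closures in $\mathbb R^k$ of $\{(\mu(B_1),\dots,\mu(B_k)):\mu\in\Theta_0\}$ and $\{(\mu(B_1),\dots,\mu(B_k)):\mu\in\Theta_1\}$ have no common points. (c) Let $\Omega$ be Hausdorff. If $\Theta_0,\Theta_1$ are distinguishable, then they are uniformly discernible, and there are tests $K_n$ that uniformly discern them with a random variable $N$ such that $\sup_{\mu\in\Theta_0\cup\Theta_1}E_\mu[\exp\{tN\}]<C<\infty$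 for some $t>0$ and some constant $C$. (d) Let $\Omega$ be Polish. If $\Theta_0$ is relatively compact in the weak topology, then $\Theta_0$ is uniformly asymptotically discernible. -/

import Mathlib

open MeasureTheory Filter Topology
open scoped NNReal ENNReal Nat

noncomputable section

namespace PoissonTesting

/-! ### Poisson random processes -/

section PoissonProcess

variable {Ω : Type*} [MeasurableSpace Ω]

/-- The point configuration `δ_{x₁} + ⋯ + δ_{x_k}`. -/
def pointConfiguration (k : ℕ) (x : Fin k → Ω) : Measure Ω :=
  ∑ i, Measure.dirac (x i)

theorem measurable_pointConfiguration (k : ℕ) :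
    Measurable (pointConfiguration (Ω := Ω) k) := by
  refine Measure.measurable_of_measurable_coe _ fun s hs => ?_
  simp only [pointConfiguration, Measure.finsetSum_apply]
  exact Finset.measurable_sum _ fun i _ =>
    (Measure.measurable_coe hs).comp (Measure.measurable_dirac.comp (measurable_pi_apply i))

/-- The law of the Poisson random process with finite mean measure `μ`, a law on the space of
measures on `Ω` with the σ-algebra generated by the evaluations `κ ↦ κ B`, `B` measurable.
The total number of points is Poisson distributed with parameter `μ Ω` and, given that there are
`k` points, these are independent with common law `μ / μ Ω`; in other words, the configurations
with `k` points contribute the image of `e^{-μ Ω} / k! • μ^{⊗ k}` under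
`x ↦ δ_{x₁} + ⋯ + δ_{x_k}`. -/
def poissonLaw (μ : FiniteMeasure Ω) : Measure (Measure Ω) :=
  Measure.sum fun k : ℕ =>
    ENNReal.ofReal (Real.exp (-(μ.mass : ℝ)) / (k ! : ℝ)) •
      Measure.map (pointConfiguration k) (Measure.pi fun _ : Fin k => (μ : Measure Ω))

instance (μ : FiniteMeasure Ω) : IsProbabilityMeasure (poissonLaw μ) := by
  constructor
  have h : ∀ k : ℕ, (ENNReal.ofReal (Real.exp (-(μ.mass : ℝ)) / (k ! : ℝ)) •
      Measure.map (pointConfiguration k) (Measure.pi fun _ : Fin k => (μ : Measure Ω)))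
        Set.univ = ENNReal.ofReal (Real.exp (-(μ.mass : ℝ)) * ((μ.mass : ℝ) ^ k / (k ! : ℝ))) := by
    intro k
    rw [Measure.smul_apply, Measure.map_apply (measurable_pointConfiguration k) MeasurableSet.univ,
      Set.preimage_univ, Measure.pi_univ]
    simp only [Finset.prod_const, Finset.card_univ, Fintype.card_fin, smul_eq_mul]
    rw [← FiniteMeasure.ennreal_mass, ← ENNReal.ofReal_coe_nnreal,
      ← ENNReal.ofReal_pow (by positivity), ← ENNReal.ofReal_mul (by positivity)]
    congr 1
    ring
  have hs : HasSum (fun k : ℕ => Real.exp (-(μ.mass : ℝ)) * ((μ.mass : ℝ) ^ k / (k ! : ℝ))) 1 := by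
    have := (NormedSpace.expSeries_div_hasSum_exp (μ.mass : ℝ)).mul_left
      (Real.exp (-(μ.mass : ℝ)))
    rwa [← Real.exp_eq_exp_ℝ, ← Real.exp_add, neg_add_cancel, Real.exp_zero] at this
  rw [poissonLaw, Measure.sum_apply _ MeasurableSet.univ]
  simp_rw [h]
  rw [← ENNReal.ofReal_tsum_of_nonneg (fun k => by positivity) hs.summable, hs.tsum_eq,
    ENNReal.ofReal_one]

/-- The joint law of `n` independent realizations `κ₁, …, κ_n`. -/
def sampleLaw (μ : FiniteMeasure Ω) (n : ℕ) : Measure (Fin n → Measure Ω) :=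
  Measure.pi fun _ => poissonLaw μ

/-- The joint law of an infinite sequence `κ₁, κ₂, …` of independent realizations. -/
def sequenceLaw (μ : FiniteMeasure Ω) : Measure (ℕ → Measure Ω) :=
  Measure.infinitePi fun _ => poissonLaw μ

end PoissonProcess

/-! ### Tests -/

section Tests

variable {Ω : Type*} [MeasurableSpace Ω]

/-- A (possibly randomized) test based on `n` observations: `K κ` is the probability of rejecting
the hypothesis when `κ = (κ₁, …, κ_n)` is observed. -/
structure PoissonTest (Ω : Type*) [MeasurableSpace Ω] (n : ℕ) where
  toFun : (Fin n → Measure Ω) → ℝ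
  measurable_toFun : Measurable toFun
  nonneg : ∀ κ, 0 ≤ toFun κ
  le_one : ∀ κ, toFun κ ≤ 1

/-- The type I error probability `α(K) = sup_{μ ∈ Θ₀} E_μ K`. -/
def typeI {n : ℕ} (K : PoissonTest Ω n) (Θ₀ : Set (FiniteMeasure Ω)) : ℝ :=
  ⨆ μ : Θ₀, ∫ κ, K.toFun κ ∂(sampleLaw μ.1 n)

/-- The type II error probability `β(K) = sup_{μ ∈ Θ₁} E_μ (1 - K)`. -/
def typeII {n : ℕ} (K : PoissonTest Ω n) (Θ₁ : Set (FiniteMeasure Ω)) : ℝ :=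
  ⨆ μ : Θ₁, ∫ κ, (1 - K.toFun κ) ∂(sampleLaw μ.1 n)

/-- `Θ₀` and `Θ₁` are distinguishable: for every level `a ∈ (0, 1)` there are tests `K_n` with
`α(K_n) < a` for all `n` and `β(K_n) → 0`. -/
def Distinguishable (Θ₀ Θ₁ : Set (FiniteMeasure Ω)) : Prop :=
  ∀ a : ℝ, 0 < a → a < 1 → ∃ K : ∀ n, PoissonTest Ω n,
    (∀ n, typeI (K n) Θ₀ < a) ∧ Tendsto (fun n => typeII (K n) Θ₁) atTop (𝓝 0)

/-- `Θ₀` and `Θ₁` are indistinguishable: `α(K) + β(K) ≥ 1` for every test and sample size. -/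
def Indistinguishable (Θ₀ Θ₁ : Set (FiniteMeasure Ω)) : Prop :=
  ∀ (n : ℕ) (K : PoissonTest Ω n), 1 ≤ typeI K Θ₀ + typeII K Θ₁

/-- There are tests whose error probabilities of both types are at most `exp (-c n)`, for some
`c > 0` and all sufficiently large `n`. -/
def ExponentiallyDistinguishable (Θ₀ Θ₁ : Set (FiniteMeasure Ω)) : Prop :=
  ∃ (K : ∀ n, PoissonTest Ω n) (c : ℝ) (n₀ : ℕ), 0 < c ∧ ∀ n, n₀ < n →
    typeI (K n) Θ₀ ≤ Real.exp (-c * n) ∧ typeII (K n) Θ₁ ≤ Real.exp (-c * n)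

/-! ### Discernibility -/

/-- The decision of the test `K_n` along the sequence `κ₁, κ₂, …` of observations. -/
def decision (K : ∀ n, PoissonTest Ω n) (n : ℕ) (κ : ℕ → Measure Ω) : ℝ :=
  (K n).toFun fun i => κ i

/-- The random variable `N`, a positive function of the observations, and the nonrandomized tests
`K_n` are such that almost surely for all `n > N` the test `K_n` accepts under every `μ ∈ Θ₀`
and rejects under every `μ ∈ Θ₁`. -/
structure DiscernsAfter (K : ∀ n, PoissonTest Ω n) (N : (ℕ → Measure Ω) → ℝ)
    (Θ₀ Θ₁ : Set (FiniteMeasure Ω)) : Prop where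
  nonrandomized : ∀ n κ, (K n).toFun κ = 0 ∨ (K n).toFun κ = 1
  measurable : Measurable N
  pos : ∀ κ, 0 < N κ
  accepts : ∀ μ ∈ Θ₀, ∀ᵐ κ ∂(sequenceLaw μ), ∀ n : ℕ, N κ < n → decision K n κ = 0
  rejects : ∀ μ ∈ Θ₁, ∀ᵐ κ ∂(sequenceLaw μ), ∀ n : ℕ, N κ < n → decision K n κ = 1

/-- `lim_{C → ∞} sup_{μ ∈ Θ₀ ∪ Θ₁} P_μ(N > C) = 0`. -/
def UniformlyBounded (N : (ℕ → Measure Ω) → ℝ) (Θ₀ Θ₁ : Set (FiniteMeasure Ω)) : Prop :=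
  Tendsto (fun C : ℝ => ⨆ μ ∈ Θ₀ ∪ Θ₁, sequenceLaw μ {κ | C < N κ}) atTop (𝓝 0)

/-- The sequence of tests `K_n` uniformly discerns `Θ₀` and `Θ₁`. -/
def UniformlyDiscerns (K : ∀ n, PoissonTest Ω n) (Θ₀ Θ₁ : Set (FiniteMeasure Ω)) : Prop :=
  ∃ N : (ℕ → Measure Ω) → ℝ, DiscernsAfter K N Θ₀ Θ₁ ∧ UniformlyBounded N Θ₀ Θ₁

/-- `Θ₀` and `Θ₁` are uniformly discernible. -/
def UniformlyDiscernible (Θ₀ Θ₁ : Set (FiniteMeasure Ω)) : Prop :=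
  ∃ K : ∀ n, PoissonTest Ω n, UniformlyDiscerns K Θ₀ Θ₁

/-- There are tests `K_n` and a uniformly bounded `N` discerning `Θ₀` and `Θ₁`, with
`sup_{μ ∈ Θ₀ ∪ Θ₁} E_μ exp(t N) < C < ∞` for some `t > 0`. -/
def UniformlyDiscernibleExpMoment (Θ₀ Θ₁ : Set (FiniteMeasure Ω)) : Prop :=
  ∃ (K : ∀ n, PoissonTest Ω n) (N : (ℕ → Measure Ω) → ℝ),
    DiscernsAfter K N Θ₀ Θ₁ ∧ UniformlyBounded N Θ₀ Θ₁ ∧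
      ∃ (t : ℝ) (C : ℝ≥0), 0 < t ∧
        ⨆ μ ∈ Θ₀ ∪ Θ₁, ∫⁻ κ, ENNReal.ofReal (Real.exp (t * N κ)) ∂(sequenceLaw μ) < (C : ℝ≥0∞)

end Tests

/-! ### Topologies on the set of finite measures

The weak topology is the topological structure that `FiniteMeasure Ω` carries in the library. -/

section Topologies

variable {Ω : Type*}

/-- The `τ`-topology: the coarsest topology for which `μ ↦ μ B` is continuous for every
measurable set `B`. -/
@[reducible] def tauTopology (Ω : Type*) [MeasurableSpace Ω] : TopologicalSpace (FiniteMeasure Ω) :=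
  ⨅ B : {B : Set Ω // MeasurableSet B},
    TopologicalSpace.induced (fun μ : FiniteMeasure Ω => μ B.1) inferInstance

/-- The closure of `Θ₀` in the `τ`-topology is `τ`-compact. -/
def TauRelativelyCompact [MeasurableSpace Ω] (Θ₀ : Set (FiniteMeasure Ω)) : Prop :=
  @IsCompact _ (tauTopology Ω) (@closure _ (tauTopology Ω) Θ₀)

/-- The closure of `Θ₀` in the weak topology is weakly compact. -/
def WeaklyRelativelyCompact [TopologicalSpace Ω] [MeasurableSpace Ω] [OpensMeasurableSpace Ω]
    (Θ₀ : Set (FiniteMeasure Ω)) : Prop :=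
  IsCompact (closure Θ₀)

/-- `Θ₀` is uniformly asymptotically discernible: there are sets `Θ_k` increasing in `k` that
together with the weak closure of `Θ₀` cover the set of all finite measures, and one sequence of
tests that, for every `k`, uniformly discerns `Θ₀` and `Θ_k`. -/
def UniformlyAsymptoticallyDiscernible [TopologicalSpace Ω] [MeasurableSpace Ω]
    [OpensMeasurableSpace Ω] (Θ₀ : Set (FiniteMeasure Ω)) : Prop :=
  ∃ (Θ' : ℕ → Set (FiniteMeasure Ω)) (K : ∀ n, PoissonTest Ω n),
    (∀ k, Θ' k ⊆ Θ' (k + 1)) ∧ (⋃ k, Θ' k) ∪ closure Θ₀ = Set.univ ∧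
      ∀ k, UniformlyDiscerns K Θ₀ (Θ' k)

/-- The vectors `(μ(B₁), …, μ(B_k))`, `μ ∈ Θ₀`. -/
def valueSet [MeasurableSpace Ω] {k : ℕ} (B : Fin k → Set Ω) (Θ₀ : Set (FiniteMeasure Ω)) :
    Set (Fin k → ℝ) :=
  (fun μ i => ((μ (B i) : ℝ≥0) : ℝ)) '' Θ₀

end Topologies

end PoissonTesting

end

noncomputable section

namespace PoissonTesting

/-! ### Integrals of bounded functions and measures of superlevel sets -/

section Superlevel

variable {X : Type*} [MeasurableSpace X]

/-! The positive statements rest on one principle, `exists_hasErrorBound_of_separated`: if finitely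
many `[0, 1]`-valued statistics of `m` observations have mean vectors a fixed distance apart under
the two hypotheses, their averages over disjoint blocks concentrate by Hoeffding's inequality, so
checking whether the averages lie near a mean vector of `Θ₀` errs with exponentially small
probability. For (c) the statistic is a single test with both errors below `1/3`; Borel–Cantelli and
summation of the tails then control the time after which the decision no longer changes.

For (b), if no finite family of open sets separated `Θ₀` from `Θ₁`, pairs that agree ever better on
ever more open sets would, by compactness of one closure, share a weak limit: integrals of bounded
continuous functions are recovered from the measures of their open superlevel sets. For (a)(ii),
these open sets yield bounded statistics, the indicators that `B` contains no point, with means `exp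
(-μ B)`.

For (a)(i), setwise continuous families over a compact space are uniformly countably additive
(Dini). Hence setwise continuity passes to products and to Poisson laws, and `E_μ K` is
`τ`-continuous on each `τ`-closure; these contain the weak closures, so a common weak limit forces
`α + β ≥ 1`.

For (d), the complement of the compact set `closure Θ₀` is a countable increasing union of closed
sets. Part (a)(ii) applies to each of them, and a slowly growing index merges the resulting tests.
-/

theorem sum_range_indicator_lt (a : ℝ) (L : ℕ) (ha : a ≤ L) :
    ∑ j ∈ Finset.range L, (if (j : ℝ) < a then (1 : ℝ) else 0) = ⌈a⌉₊ := by
  rw [← Finset.sum_filter, Finset.sum_const, nsmul_eq_mul, mul_one]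
  congr 1
  have : (Finset.range L).filter (fun j : ℕ => (j : ℝ) < a) = Finset.range ⌈a⌉₊ := by
    ext j
    simp only [Finset.mem_filter, Finset.mem_range, Nat.lt_ceil]
    refine ⟨fun h => h.2, fun h => ⟨?_, h⟩⟩
    exact_mod_cast h.trans_le ha
  rw [this, Finset.card_range]

/-- A bounded measurable function is integrated up to an error `μ(X) / m` by the measures of its
superlevel sets. -/
theorem abs_integral_sub_sum_superlevel_le {f : X → ℝ} (hf : Measurable f) {C : ℝ}
    (h0 : ∀ x, 0 ≤ f x) (hC : ∀ x, f x ≤ C) {m : ℕ} (hm : 0 < m) {L : ℕ} (hL : m * C ≤ L)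
    (μ : Measure X) [IsFiniteMeasure μ] :
    |∫ x, f x ∂μ - (∑ j ∈ Finset.range L, μ.real {x | (j : ℝ) < m * f x}) / m|
      ≤ μ.real Set.univ / m := by
  have hm' : (0 : ℝ) < m := by exact_mod_cast hm
  have hset : ∀ j : ℕ, MeasurableSet {x | (j : ℝ) < m * f x} := fun j =>
    measurableSet_lt measurable_const (hf.const_mul _)
  have hint : Integrable f μ := by
    refine Integrable.of_bound hf.aestronglyMeasurable C (ae_of_all _ fun x => ?_)
    rw [Real.norm_of_nonneg (h0 x)]
    exact hC x
  have hind : ∀ j : ℕ, Integrable (fun x => if (j : ℝ) < m * f x then (1 : ℝ) else 0) μ := fun j =>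
    Integrable.of_bound (Measurable.ite (hset j) measurable_const
      measurable_const).aestronglyMeasurable 1 (ae_of_all _ fun x => by split_ifs <;> simp)
  -- Discrete layer cake: exactly `⌈m f x⌉₊` naturals `j` satisfy `j < m f x`. The inequality is
  -- strict so that the superlevel sets of a continuous `f` are open.
  have hsum : (∑ j ∈ Finset.range L, μ.real {x | (j : ℝ) < m * f x}) / m
      = ∫ x, (⌈m * f x⌉₊ : ℝ) / m ∂μ := by
    rw [integral_div]
    congr 1
    have : ∀ x, (⌈m * f x⌉₊ : ℝ) =
        ∑ j ∈ Finset.range L, (if (j : ℝ) < m * f x then (1 : ℝ) else 0) := fun x =>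
      (sum_range_indicator_lt _ _ ((mul_le_mul_of_nonneg_left (hC x) hm'.le).trans hL)).symm
    simp_rw [this]
    rw [integral_finsetSum _ fun j _ => hind j]
    refine Finset.sum_congr rfl fun j _ => ?_
    rw [← integral_indicator_one (hset j)]
    rfl
  have hceil : Integrable (fun x => (⌈m * f x⌉₊ : ℝ) / m) μ := by
    refine Integrable.of_bound
      (((measurable_from_top (f := fun k : ℕ => (k : ℝ))).comp
        (Nat.measurable_ceil.comp (hf.const_mul _))).div_const _).aestronglyMeasurable (L / m) (ae_of_all _ fun x => ?_)
    rw [Real.norm_of_nonneg (by positivity)]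
    gcongr
    exact_mod_cast Nat.ceil_le.2 ((mul_le_mul_of_nonneg_left (hC x) hm'.le).trans hL)
  rw [hsum, ← integral_sub hint hceil]
  have : ∀ x, ‖f x - (⌈m * f x⌉₊ : ℝ) / m‖ ≤ 1 / m := by
    intro x
    have h1 := Nat.le_ceil (m * f x)
    have h2 := Nat.ceil_lt_add_one (mul_nonneg hm'.le (h0 x))
    rw [Real.norm_eq_abs, show f x - (⌈m * f x⌉₊ : ℝ) / m = (m * f x - ⌈m * f x⌉₊) / m by
      field_simp, abs_div, abs_of_pos hm']
    gcongr
    rw [abs_le]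
    constructor <;> linarith
  calc |∫ x, f x - (⌈m * f x⌉₊ : ℝ) / m ∂μ| ≤ 1 / m * μ.real Set.univ :=
        norm_integral_le_of_norm_le_const (ae_of_all _ this)
    _ = _ := by ring

/-- If the measures of the superlevel sets of a bounded measurable function are asymptotically
equal, then so are its integrals. -/
theorem tendsto_integral_sub_of_superlevel {ι : Type*} {l : Filter ι} {a b : ι → Measure X}
    [∀ i, IsFiniteMeasure (a i)] [∀ i, IsFiniteMeasure (b i)] {f : X → ℝ} (hf : Measurable f)
    {C : ℝ} (h0 : ∀ x, 0 ≤ f x) (hC : ∀ x, f x ≤ C) {M : ℝ}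
    (ha : ∀ᶠ i in l, (a i).real Set.univ ≤ M) (hb : ∀ᶠ i in l, (b i).real Set.univ ≤ M)
    (h : ∀ m j : ℕ, Tendsto (fun i => (a i).real {x | (j : ℝ) < m * f x} -
      (b i).real {x | (j : ℝ) < m * f x}) l (𝓝 0)) :
    Tendsto (fun i => ∫ x, f x ∂(a i) - ∫ x, f x ∂(b i)) l (𝓝 0) := by
  rw [Metric.tendsto_nhds]
  intro ε hε
  -- Each of the two measures contributes a discretization error below `ε / 4`, and the finite sum
  -- of differences another `ε / 4`.
  obtain ⟨m, hm⟩ := exists_nat_gt (max 0 (4 * M / ε))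
  have hm0 : (0 : ℝ) < m := (le_max_left _ _).trans_lt hm
  have hm1 : M / m < ε / 4 := by
    have := (le_max_right _ _).trans_lt hm
    rw [div_lt_iff₀ hε] at this
    rw [div_lt_iff₀ hm0]
    linarith
  obtain ⟨L, hL⟩ := exists_nat_ge (m * C)
  have hlim : Tendsto (fun i => (∑ j ∈ Finset.range L, ((a i).real {x | (j : ℝ) < m * f x} -
      (b i).real {x | (j : ℝ) < m * f x})) / m) l (𝓝 0) := by
    have := (tendsto_finsetSum (Finset.range L) fun j _ => h m j).div_const (m : ℝ)
    simpa using this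
  filter_upwards [ha, hb, (Metric.tendsto_nhds.1 hlim) (ε / 4) (by linarith)] with i hai hbi hi
  rw [Real.dist_0_eq_abs] at hi ⊢
  have hm2 : 0 < m := by exact_mod_cast hm0
  have h1 := abs_integral_sub_sum_superlevel_le hf h0 hC hm2 hL (a i)
  have h2 := abs_integral_sub_sum_superlevel_le hf h0 hC hm2 hL (b i)
  have h3 : (a i).real Set.univ / m ≤ M / m := by gcongr
  have h4 : (b i).real Set.univ / m ≤ M / m := by gcongr
  rw [Finset.sum_sub_distrib, sub_div] at hi
  rw [abs_le] at h1 h2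
  rw [abs_lt] at hi ⊢
  constructor <;> linarith [h1.1, h1.2, h2.1, h2.2, hi.1, hi.2]

end Superlevel

/-! ### Setwise continuous families of measures on a compact parameter space -/

section Setwise

variable {T X Y : Type*} [TopologicalSpace T] [MeasurableSpace X] [MeasurableSpace Y]

/-- A family of measures is setwise continuous if the measure of every measurable set depends
continuously on the parameter. -/
def SetwiseContinuous (m : T → Measure X) : Prop :=
  ∀ B, MeasurableSet B → Continuous fun t => (m t).real B

theorem SetwiseContinuous.map {m : T → Measure X} (hm : SetwiseContinuous m) {f : X → Y}
    (hf : Measurable f) : SetwiseContinuous fun t => (m t).map f := by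
  intro B hB
  simp_rw [map_measureReal_apply hf hB]
  exact hm _ (hf hB)

theorem SetwiseContinuous.continuous_integral {m : T → Measure X} [∀ t, IsFiniteMeasure (m t)]
    (hm : SetwiseContinuous m) {f : X → ℝ} (hf : Measurable f) {C : ℝ} (h0 : ∀ x, 0 ≤ f x)
    (hC : ∀ x, f x ≤ C) : Continuous fun t => ∫ x, f x ∂(m t) := by
  rw [continuous_iff_continuousAt]
  intro s
  have hmass : ∀ᶠ t in 𝓝 s, (m t).real Set.univ ≤ (m s).real Set.univ + 1 :=
    ((hm _ MeasurableSet.univ).tendsto s).eventually_le_const (lt_add_one _)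
  have := tendsto_integral_sub_of_superlevel (l := 𝓝 s) (a := m) (b := fun _ => m s) hf h0 hC
    hmass (Eventually.of_forall fun _ => by linarith) fun k j => by
      have := ((hm {x | (j : ℝ) < k * f x}
        (measurableSet_lt measurable_const (hf.const_mul _))).tendsto s).sub_const
        ((m s).real {x | (j : ℝ) < k * f x})
      simpa using this
  simpa [ContinuousAt] using this.add_const (∫ x, f x ∂(m s))

theorem SetwiseContinuous.exists_mass_le [CompactSpace T] {m : T → Measure X}
    (hm : SetwiseContinuous m) : ∃ M : ℝ, 0 < M ∧ ∀ t, (m t).real Set.univ ≤ M := by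
  obtain ⟨M, hM⟩ := (isCompact_range (hm _ MeasurableSet.univ)).bddAbove
  exact ⟨max M 1, by positivity, fun t => (hM ⟨t, rfl⟩).trans (le_max_left _ _)⟩

/-- A setwise continuous family over a compact space is uniformly countably additive. -/
theorem SetwiseContinuous.exists_le_of_antitone [CompactSpace T] {m : T → Measure X}
    [∀ t, IsFiniteMeasure (m t)] (hm : SetwiseContinuous m) {B : ℕ → Set X}
    (hB : ∀ n, MeasurableSet (B n)) (hanti : Antitone B) (hempty : ⋂ n, B n = ∅) {ε : ℝ}
    (hε : 0 < ε) : ∃ n, ∀ t, (m t).real (B n) ≤ ε := by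
  -- Dini's theorem: continuous functions decreasing to `0` on a compact space do so uniformly.
  have h := Antitone.tendstoUniformly_of_forall_tendsto (F := fun n t => (m t).real (B n))
    (f := fun _ => 0) (fun n => hm _ (hB n))
    (fun i j hij t => measureReal_mono (hanti hij)) continuous_const fun t => by
      have := tendsto_measure_iInter_atTop (μ := m t) (fun n => (hB n).nullMeasurableSet) hanti
        ⟨0, measure_ne_top _ _⟩
      rw [hempty, measure_empty] at this
      simpa [Measure.real, Function.comp_def] using (ENNReal.tendsto_toReal ENNReal.zero_ne_top).comp this
  obtain ⟨n, hn⟩ := ((Metric.tendstoUniformly_iff.1 h) ε hε).exists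
  refine ⟨n, fun t => ?_⟩
  have := hn t
  rw [dist_comm, Real.dist_0_eq_abs] at this
  exact ((le_abs_self _).trans_lt this).le

/-- Dini's theorem does not apply directly, since setwise continuity of the product is what this
lemma is meant to prove. Instead, uniform countable additivity of `m'` makes the supremum over
parameters of the section measures tend to `0` pointwise, and that of `m` makes the set where this
supremum is large uniformly small. -/
theorem SetwiseContinuous.prod_exists_le_of_antitone [CompactSpace T] {m : T → Measure X}
    {m' : T → Measure Y} [∀ t, IsFiniteMeasure (m t)] [∀ t, IsFiniteMeasure (m' t)]
    (hm : SetwiseContinuous m) (hm' : SetwiseContinuous m') {B : ℕ → Set (X × Y)}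
    (hB : ∀ n, MeasurableSet (B n)) (hanti : Antitone B) (hempty : ⋂ n, B n = ∅) {ε : ℝ}
    (hε : 0 < ε) : ∃ n, ∀ t, ((m t).prod (m' t)).real (B n) ≤ ε := by
  by_contra! hcon
  -- Only a sequence of bad parameters is kept, so the supremum `g n` is countable and hence
  -- measurable.
  choose t ht using hcon
  obtain ⟨M, hM0, hM⟩ := hm.exists_mass_le
  obtain ⟨M', hM0', hM'⟩ := hm'.exists_mass_le
  set g : ℕ → X → ℝ≥0∞ := fun n x => ⨆ j, m' (t j) (Prod.mk x ⁻¹' B n) with hg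
  have hgm : ∀ n, Measurable (g n) := fun n =>
    Measurable.iSup fun j => measurable_measure_prodMk_left (hB n)
  -- Short sections contribute at most `δ M = ε / 2`, and `E n` at most `M' ε / (2 M') = ε / 2`.
  set δ : ℝ := ε / (2 * M) with hδ
  have hδ0 : 0 < δ := by positivity
  set E : ℕ → Set X := fun n => {x | ENNReal.ofReal δ < g n x} with hE
  have hEm : ∀ n, MeasurableSet (E n) := fun n => measurableSet_lt measurable_const (hgm n)
  have hEanti : Antitone E := fun i j hij x (hx : _ < _) =>
    hx.trans_le (iSup_mono fun k => measure_mono (Set.preimage_mono (hanti hij)))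
  have hEempty : ⋂ n, E n = ∅ := by
    rw [Set.eq_empty_iff_forall_notMem]
    intro x hx
    obtain ⟨n, hn⟩ := hm'.exists_le_of_antitone (B := fun n => Prod.mk x ⁻¹' B n)
      (fun n => measurable_prodMk_left (hB n)) (fun i j hij => Set.preimage_mono (hanti hij))
      (by rw [← Set.preimage_iInter, hempty, Set.preimage_empty]) hδ0
    have h1 : ENNReal.ofReal δ < g n x := Set.mem_iInter.1 hx n
    refine absurd h1 (not_lt.2 (iSup_le fun j => ?_))
    rw [← ofReal_measureReal]
    exact ENNReal.ofReal_le_ofReal (hn _)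
  obtain ⟨n, hn⟩ := hm.exists_le_of_antitone hEm hEanti hEempty (ε := ε / (2 * M')) (by positivity)
  have hgb : ∀ x, m' (t n) (Prod.mk x ⁻¹' B n) ≤
      ENNReal.ofReal δ + (E n).indicator (fun _ => ENNReal.ofReal M') x := by
    intro x
    by_cases hx : x ∈ E n
    · rw [Set.indicator_of_mem hx]
      refine le_add_left ((measure_mono (Set.subset_univ _)).trans ?_)
      rw [← ofReal_measureReal]
      exact ENNReal.ofReal_le_ofReal (hM' _)
    · rw [Set.indicator_of_notMem hx, add_zero]
      exact (le_iSup (fun j => m' (t j) (Prod.mk x ⁻¹' B n)) n).trans (not_lt.1 hx)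
  have hle : ((m (t n)).prod (m' (t n))) (B n) ≤ ENNReal.ofReal ε := by
    rw [Measure.prod_apply (hB n)]
    calc ∫⁻ x, m' (t n) (Prod.mk x ⁻¹' B n) ∂(m (t n))
        ≤ ∫⁻ x, (ENNReal.ofReal δ + (E n).indicator (fun _ => ENNReal.ofReal M') x) ∂(m (t n)) :=
          lintegral_mono hgb
      _ = ENNReal.ofReal δ * m (t n) Set.univ + ENNReal.ofReal M' * m (t n) (E n) := by
          rw [lintegral_add_left measurable_const, lintegral_const,
            lintegral_indicator_const (hEm n)]
      _ ≤ ENNReal.ofReal δ * ENNReal.ofReal M + ENNReal.ofReal M' * ENNReal.ofReal (ε / (2 * M')) := by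
          rw [← ofReal_measureReal (μ := m (t n)) (s := Set.univ),
            ← ofReal_measureReal (μ := m (t n)) (s := E n)]
          gcongr
          · exact hM _
          · exact hn _
      _ = ENNReal.ofReal ε := by
          rw [← ENNReal.ofReal_mul hδ0.le, ← ENNReal.ofReal_mul hM0'.le,
            ← ENNReal.ofReal_add (by positivity) (by positivity)]
          congr 1
          rw [hδ]
          field_simp
          ring
  have := ENNReal.toReal_mono ENNReal.ofReal_ne_top hle
  rw [ENNReal.toReal_ofReal hε.le] at this
  exact absurd (ht n) (not_lt.2 this)

/-- The sets of continuous measure contain the rectangles and are closed under complements. For a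
countable disjoint union, the finite partial unions converge uniformly in the parameter by the
preceding lemma, so the limit is continuous. -/
theorem SetwiseContinuous.prod [CompactSpace T] {m : T → Measure X} {m' : T → Measure Y}
    [∀ t, IsFiniteMeasure (m t)] [∀ t, IsFiniteMeasure (m' t)] (hm : SetwiseContinuous m)
    (hm' : SetwiseContinuous m') : SetwiseContinuous fun t => (m t).prod (m' t) := by
  intro B hB
  induction B, hB using MeasurableSpace.induction_on_inter
    (generateFrom_prod (α := X) (β := Y)).symm isPiSystem_prod with
  | empty => simpa using continuous_const
  | basic B hB =>
    obtain ⟨s, hs, u, hu, rfl⟩ := hB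
    simp_rw [measureReal_prod_prod]
    exact (hm s hs).mul (hm' u hu)
  | compl B hB ih =>
    simp_rw [measureReal_compl hB, ← Set.univ_prod_univ, measureReal_prod_prod]
    exact ((hm _ MeasurableSet.univ).mul (hm' _ MeasurableSet.univ)).sub ih
  | iUnion A hd hA ih =>
    have hfin : ∀ n, Continuous fun t =>
        ((m t).prod (m' t)).real (⋃ i ∈ Finset.range n, A i) := by
      intro n
      have h : ∀ t, ((m t).prod (m' t)).real (⋃ i ∈ Finset.range n, A i) =
          ∑ i ∈ Finset.range n, ((m t).prod (m' t)).real (A i) := fun t =>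
        measureReal_biUnion_finset (fun i _ j _ hij => hd hij) fun i _ => hA i
      simp_rw [h]
      exact continuous_finsetSum _ fun i _ => ih i
    have hfinm : ∀ n, MeasurableSet (⋃ i ∈ Finset.range n, A i) := fun n =>
      Finset.measurableSet_biUnion _ fun i _ => hA i
    have hmono : Monotone fun n => ⋃ i ∈ Finset.range n, A i := fun i j hij =>
      Set.biUnion_subset_biUnion_left fun k hk => by
        simp only [Finset.coe_range, Set.mem_Iio] at hk ⊢
        exact hk.trans_le hij
    have hunif : TendstoUniformly
        (fun n t => ((m t).prod (m' t)).real (⋃ i ∈ Finset.range n, A i))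
        (fun t => ((m t).prod (m' t)).real (⋃ i, A i)) atTop := by
      rw [Metric.tendstoUniformly_iff]
      intro ε hε
      obtain ⟨n, hn⟩ := hm.prod_exists_le_of_antitone hm'
        (B := fun n => (⋃ i, A i) \ ⋃ i ∈ Finset.range n, A i)
        (fun n => (MeasurableSet.iUnion hA).diff (hfinm n))
        (fun i j hij => Set.sdiff_subset_sdiff_right (hmono hij)) (by
          rw [Set.eq_empty_iff_forall_notMem]
          intro x hx
          rw [Set.mem_iInter] at hx
          obtain ⟨i, hi⟩ := Set.mem_iUnion.1 (hx 0).1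
          refine (hx (i + 1)).2 ?_
          simp only [Set.mem_iUnion, Finset.mem_range]
          exact ⟨i, Nat.lt_succ_self i, hi⟩) (half_pos hε)
      filter_upwards [eventually_ge_atTop n] with k hk t
      have hsub : (⋃ i ∈ Finset.range k, A i) ⊆ ⋃ i, A i :=
        Set.iUnion₂_subset fun i _ => Set.subset_iUnion A i
      rw [Real.dist_eq, ← measureReal_sdiff hsub (hfinm k), abs_of_nonneg measureReal_nonneg]
      refine lt_of_le_of_lt (measureReal_mono (Set.sdiff_subset_sdiff_right (hmono hk))) ?_
      exact (hn t).trans_lt (half_lt_self hε)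
    exact hunif.continuous (Frequently.of_forall hfin)

theorem SetwiseContinuous.pi [CompactSpace T] {m : T → Measure X} [∀ t, IsFiniteMeasure (m t)]
    (hm : SetwiseContinuous m) (k : ℕ) :
    SetwiseContinuous fun t => Measure.pi fun _ : Fin k => m t := by
  induction k with
  | zero =>
    intro B hB
    have h : ∀ t, (Measure.pi fun _ : Fin 0 => m t) = Measure.dirac isEmptyElim := fun t =>
      Measure.pi_of_empty _ _
    simp_rw [h]
    exact continuous_const
  | succ k ih =>
    have h : ∀ t, (Measure.pi fun _ : Fin (k + 1) => m t) =
        ((m t).prod (Measure.pi fun _ : Fin k => m t)).map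
          (MeasurableEquiv.piFinSuccAbove (fun _ : Fin (k + 1) => X) 0).symm := fun t =>
      ((measurePreserving_piFinSuccAbove (fun _ : Fin (k + 1) => m t) 0).symm _).map_eq.symm
    simp_rw [h]
    exact (hm.prod ih).map (MeasurableEquiv.measurable _)

end Setwise

/-! ### Setwise continuity of the Poisson law -/

section PoissonSetwise

variable {T Ω : Type*} [TopologicalSpace T] [MeasurableSpace Ω]

theorem poissonLaw_apply (μ : FiniteMeasure Ω) {B : Set (Measure Ω)} (hB : MeasurableSet B) :
    poissonLaw μ B = ∑' k : ℕ, ENNReal.ofReal (Real.exp (-(μ.mass : ℝ)) / (k ! : ℝ)) *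
      (Measure.pi fun _ : Fin k => (μ : Measure Ω)) (pointConfiguration k ⁻¹' B) := by
  rw [poissonLaw, Measure.sum_apply _ hB]
  simp_rw [Measure.smul_apply, smul_eq_mul, Measure.map_apply (measurable_pointConfiguration _) hB]

theorem poissonLaw_real_apply (μ : FiniteMeasure Ω) {B : Set (Measure Ω)} (hB : MeasurableSet B) :
    (poissonLaw μ).real B = ∑' k : ℕ, Real.exp (-(μ.mass : ℝ)) / (k ! : ℝ) *
      (Measure.pi fun _ : Fin k => (μ : Measure Ω)).real (pointConfiguration k ⁻¹' B) := by
  rw [Measure.real, poissonLaw_apply μ hB, ENNReal.tsum_toReal_eq fun k =>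
    ENNReal.mul_ne_top ENNReal.ofReal_ne_top (measure_ne_top _ _)]
  refine tsum_congr fun k => ?_
  rw [ENNReal.toReal_mul, ENNReal.toReal_ofReal (by positivity)]
  rfl

/-- Each term of the Poisson series is continuous, and the uniform mass bound `M` dominates the
terms by `M ^ k / k!`. -/
theorem SetwiseContinuous.poissonLaw [CompactSpace T] {m : T → FiniteMeasure Ω}
    (hm : SetwiseContinuous fun t => (m t : Measure Ω)) :
    SetwiseContinuous fun t => poissonLaw (m t) := by
  intro B hB
  simp_rw [poissonLaw_real_apply _ hB]
  obtain ⟨M, hM0, hM⟩ := hm.exists_mass_le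
  have hmass : ∀ t, ((m t).mass : ℝ) = (m t : Measure Ω).real Set.univ := fun t => rfl
  refine continuous_tsum (u := fun k : ℕ => M ^ k / (k ! : ℝ)) (fun k => ?_)
    (Real.summable_pow_div_factorial M) fun k t => ?_
  · refine Continuous.mul ?_ (hm.pi k _ (measurable_pointConfiguration k hB))
    simp_rw [hmass]
    exact (Real.continuous_exp.comp (hm _ MeasurableSet.univ).neg).div_const _
  · rw [Real.norm_of_nonneg (mul_nonneg (by positivity) measureReal_nonneg), div_mul_eq_mul_div]
    gcongr
    have h1 : (Measure.pi fun _ : Fin k => (m t : Measure Ω)).real (pointConfiguration k ⁻¹' B)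
        ≤ M ^ k := by
      refine (measureReal_mono (Set.subset_univ _)).trans ?_
      rw [Measure.real, Measure.pi_univ, ENNReal.toReal_prod]
      simp only [Finset.prod_const, Finset.card_univ, Fintype.card_fin]
      exact pow_le_pow_left₀ ENNReal.toReal_nonneg (hM t) k
    have h2 : Real.exp (-((m t).mass : ℝ)) ≤ 1 := Real.exp_le_one_iff.2 (by simp)
    calc _ ≤ 1 * M ^ k := mul_le_mul h2 h1 measureReal_nonneg zero_le_one
      _ = _ := one_mul _

end PoissonSetwise

/-! ### Error probabilities -/

section ErrorProbabilities

variable {Ω : Type*} [MeasurableSpace Ω]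

instance (μ : FiniteMeasure Ω) (n : ℕ) : IsProbabilityMeasure (sampleLaw μ n) := by
  unfold sampleLaw; infer_instance

instance (μ : FiniteMeasure Ω) : IsProbabilityMeasure (sequenceLaw μ) := by
  unfold sequenceLaw; infer_instance

theorem PoissonTest.integrable {n : ℕ} (K : PoissonTest Ω n) (P : Measure (Fin n → Measure Ω))
    [IsFiniteMeasure P] : Integrable K.toFun P :=
  Integrable.of_bound K.measurable_toFun.aestronglyMeasurable 1 (ae_of_all _ fun κ => by
    rw [Real.norm_of_nonneg (K.nonneg κ)]; exact K.le_one κ)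

theorem PoissonTest.integral_mem_Icc {n : ℕ} (K : PoissonTest Ω n)
    (P : Measure (Fin n → Measure Ω)) [IsProbabilityMeasure P] :
    ∫ κ, K.toFun κ ∂P ∈ Set.Icc (0 : ℝ) 1 := by
  refine ⟨integral_nonneg K.nonneg, ?_⟩
  have := integral_mono (K.integrable P) (integrable_const 1) K.le_one
  simpa using this

theorem PoissonTest.integral_one_sub {n : ℕ} (K : PoissonTest Ω n)
    (P : Measure (Fin n → Measure Ω)) [IsProbabilityMeasure P] :
    ∫ κ, (1 - K.toFun κ) ∂P = 1 - ∫ κ, K.toFun κ ∂P := by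
  rw [integral_sub (integrable_const 1) (K.integrable P)]
  simp

theorem integral_le_typeI {n : ℕ} (K : PoissonTest Ω n) {Θ : Set (FiniteMeasure Ω)}
    {μ : FiniteMeasure Ω} (hμ : μ ∈ Θ) : ∫ κ, K.toFun κ ∂(sampleLaw μ n) ≤ typeI K Θ :=
  le_ciSup (f := fun μ : Θ => ∫ κ, K.toFun κ ∂(sampleLaw μ.1 n))
    ⟨1, by rintro _ ⟨ν, rfl⟩; exact (K.integral_mem_Icc _).2⟩ ⟨μ, hμ⟩

theorem integral_le_typeII {n : ℕ} (K : PoissonTest Ω n) {Θ : Set (FiniteMeasure Ω)}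
    {μ : FiniteMeasure Ω} (hμ : μ ∈ Θ) : ∫ κ, (1 - K.toFun κ) ∂(sampleLaw μ n) ≤ typeII K Θ :=
  le_ciSup (f := fun μ : Θ => ∫ κ, (1 - K.toFun κ) ∂(sampleLaw μ.1 n))
    ⟨1, by
      rintro _ ⟨ν, rfl⟩
      simp only [K.integral_one_sub]
      linarith [(K.integral_mem_Icc (sampleLaw ν.1 n)).1]⟩ ⟨μ, hμ⟩

theorem typeII_nonneg {n : ℕ} (K : PoissonTest Ω n) (Θ : Set (FiniteMeasure Ω)) :
    0 ≤ typeII K Θ :=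
  Real.iSup_nonneg fun _ => integral_nonneg fun κ => sub_nonneg.2 (K.le_one κ)

end ErrorProbabilities

/-! ### Indistinguishability -/

section Tau

variable {Ω : Type*} [MeasurableSpace Ω]

/-- The set of finite measures, endowed with the `τ`-topology. -/
def TauFiniteMeasure (Ω : Type*) [MeasurableSpace Ω] : Type _ := FiniteMeasure Ω

instance : TopologicalSpace (TauFiniteMeasure Ω) := tauTopology Ω

/-- A measure viewed without the `τ`-topology. -/
def TauFiniteMeasure.toFiniteMeasure (μ : TauFiniteMeasure Ω) : FiniteMeasure Ω := μ

theorem setwiseContinuous_toFiniteMeasure :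
    SetwiseContinuous fun μ : TauFiniteMeasure Ω => (μ.toFiniteMeasure : Measure Ω) := by
  intro B hB
  have h : Continuous fun μ : TauFiniteMeasure Ω => μ.toFiniteMeasure B :=
    continuous_iInf_dom (i := ⟨B, hB⟩) continuous_induced_dom
  exact NNReal.continuous_coe.comp h

theorem lintegral_eq_ofReal_integral [TopologicalSpace Ω] [OpensMeasurableSpace Ω]
    (f : BoundedContinuousFunction Ω ℝ≥0) (μ : FiniteMeasure Ω) :
    ∫⁻ ω, f ω ∂(μ : Measure Ω) = ENNReal.ofReal (∫ ω, (f ω : ℝ) ∂(μ : Measure Ω)) := by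
  rw [ofReal_integral_eq_lintegral_ofReal]
  · simp
  · refine Integrable.of_bound (C := nndist f 0)
      (NNReal.continuous_coe.comp f.continuous).measurable.aestronglyMeasurable
      (ae_of_all _ fun x => ?_)
    rw [Real.norm_of_nonneg (NNReal.coe_nonneg _)]
    exact NNReal.coe_le_coe.2 (BoundedContinuousFunction.NNReal.upper_bound f x)
  · exact ae_of_all _ fun x => NNReal.coe_nonneg _

theorem continuous_toFiniteMeasure [TopologicalSpace Ω] [OpensMeasurableSpace Ω] :
    Continuous (TauFiniteMeasure.toFiniteMeasure : TauFiniteMeasure Ω → FiniteMeasure Ω) := by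
  rw [FiniteMeasure.continuous_iff_forall_continuous_lintegral]
  intro f
  simp_rw [lintegral_eq_ofReal_integral]
  exact ENNReal.continuous_ofReal.comp (setwiseContinuous_toFiniteMeasure.continuous_integral
    (NNReal.continuous_coe.comp f.continuous).measurable (fun x => NNReal.coe_nonneg _)
    (C := nndist f 0) fun x => NNReal.coe_le_coe.2 (BoundedContinuousFunction.NNReal.upper_bound f x))

/-- The `τ`-topology is finer than the weak one, so the `τ`-compact closure is weakly compact, and
therefore closed because the weak topology is Hausdorff. -/
theorem closure_subset_tauClosure [TopologicalSpace Ω] [BorelSpace Ω] [HasOuterApproxClosed Ω]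
    {Θ : Set (FiniteMeasure Ω)} (h : TauRelativelyCompact Θ) :
    closure Θ ⊆ @closure _ (tauTopology Ω) Θ := by
  have hc : IsCompact (TauFiniteMeasure.toFiniteMeasure ''
      (closure (X := TauFiniteMeasure Ω) Θ)) := IsCompact.image h continuous_toFiniteMeasure
  have h1 : closure Θ ⊆ TauFiniteMeasure.toFiniteMeasure '' (closure (X := TauFiniteMeasure Ω) Θ) :=
    closure_minimal (fun μ hμ => ⟨μ, subset_closure (X := TauFiniteMeasure Ω) hμ, rfl⟩) hc.isClosed
  intro μ hμ
  obtain ⟨ν, hν, rfl⟩ := h1 hμ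
  exact hν

theorem integral_sampleLaw_le_of_mem_tauClosure {Θ : Set (FiniteMeasure Ω)}
    (h : TauRelativelyCompact Θ) {μ : FiniteMeasure Ω} (hμ : μ ∈ @closure _ (tauTopology Ω) Θ)
    {n : ℕ} {f : (Fin n → Measure Ω) → ℝ} (hf : Measurable f) (h0 : ∀ κ, 0 ≤ f κ)
    (h1 : ∀ κ, f κ ≤ 1) {c : ℝ} (hc : ∀ ν ∈ Θ, ∫ κ, f κ ∂(sampleLaw ν n) ≤ c) :
    ∫ κ, f κ ∂(sampleLaw μ n) ≤ c := by
  set S : Set (TauFiniteMeasure Ω) := closure (X := TauFiniteMeasure Ω) Θ with hS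
  have : CompactSpace S := isCompact_iff_compactSpace.1 h
  have hset : SetwiseContinuous fun t : S => (t.1.toFiniteMeasure : Measure Ω) := fun B hB =>
    (setwiseContinuous_toFiniteMeasure B hB).comp continuous_subtype_val
  have hcont : ContinuousOn
      (fun t : TauFiniteMeasure Ω => ∫ κ, f κ ∂(sampleLaw t.toFiniteMeasure n)) S :=
    continuousOn_iff_continuous_domRestrict.2 ((hset.poissonLaw.pi n).continuous_integral hf h0 h1)
  -- Stated for sets in `TauFiniteMeasure Ω`, so that `closure` refers to the `τ`-topology.
  have key : ∀ s : Set (TauFiniteMeasure Ω), S = closure s →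
      (∀ ν ∈ s, ∫ κ, f κ ∂(sampleLaw ν.toFiniteMeasure n) ≤ c) →
      ∀ ν ∈ S, ∫ κ, f κ ∂(sampleLaw ν.toFiniteMeasure n) ≤ c := by
    intro s hs hsc ν hν
    exact ContinuousWithinAt.closure_le (hs ▸ hν) ((hcont ν hν).mono (hs ▸ subset_closure))
      continuousWithinAt_const hsc
  exact key Θ rfl hc μ hμ

theorem indistinguishable_of_inter_closure_nonempty [TopologicalSpace Ω] [BorelSpace Ω]
    [HasOuterApproxClosed Ω] {Θ₀ Θ₁ : Set (FiniteMeasure Ω)} (h₀ : TauRelativelyCompact Θ₀)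
    (h₁ : TauRelativelyCompact Θ₁) (h : (closure Θ₀ ∩ closure Θ₁).Nonempty) :
    Indistinguishable Θ₀ Θ₁ := by
  intro n K
  obtain ⟨μ, hμ₀, hμ₁⟩ := h
  have hα := integral_sampleLaw_le_of_mem_tauClosure h₀ (closure_subset_tauClosure h₀ hμ₀)
    K.measurable_toFun K.nonneg K.le_one fun ν hν => integral_le_typeI K hν
  have hβ := integral_sampleLaw_le_of_mem_tauClosure h₁ (closure_subset_tauClosure h₁ hμ₁)
    (f := fun κ => 1 - K.toFun κ) (measurable_const.sub K.measurable_toFun) (fun κ => sub_nonneg.2 (K.le_one κ))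
    (fun κ => sub_le_self _ (K.nonneg κ)) fun ν hν => integral_le_typeII K hν
  rw [K.integral_one_sub] at hβ
  linarith

end Tau

/-! ### Blocks of observations and Hoeffding's inequality -/

section Blocks

open ProbabilityTheory

variable {Ω : Type*} [MeasurableSpace Ω]

theorem map_restrict_sequenceLaw (μ : FiniteMeasure Ω) (n : ℕ) :
    (sequenceLaw μ).map (fun κ (i : Fin n) => κ i) = sampleLaw μ n := by
  have h : iIndepFun (fun (i : ℕ) (κ : ℕ → Measure Ω) => κ i) (sequenceLaw μ) :=
    iIndepFun_infinitePi (P := fun _ : ℕ => poissonLaw μ) (X := fun _ x => x)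
      fun _ => measurable_id
  rw [(h.precomp (g := fun i : Fin n => (i : ℕ)) Fin.val_injective).map_fun_eq_pi_map
    fun i => (measurable_pi_apply _).aemeasurable]
  simp_rw [sampleLaw, sequenceLaw, Measure.infinitePi_map_eval]

/-- Reindexing by quotient and remainder, then currying, exhibits consecutive blocks as independent
samples of size `m`, to which Hoeffding's inequality applies. -/
theorem map_blocks_sequenceLaw (μ : FiniteMeasure Ω) (m : ℕ) [NeZero m] :
    (sequenceLaw μ).map (fun κ (j : ℕ) (i : Fin m) => κ (j * m + i)) =
      Measure.infinitePi fun _ : ℕ => sampleLaw μ m := by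
  have h1 := Measure.infinitePi_map_piCongrLeft (fun _ : ℕ × Fin m => poissonLaw μ)
    (Nat.divModEquiv m)
  have h2 := Measure.infinitePi_map_curry (fun (_ : ℕ) (_ : Fin m) => poissonLaw μ)
  rw [← h1, Measure.map_map (MeasurableEquiv.measurable _) (MeasurableEquiv.measurable _)] at h2
  simp_rw [Measure.infinitePi_eq_pi] at h2
  refine Eq.trans (congrArg (fun f => Measure.map f _) ?_) h2
  ext1 κ
  funext j i
  have h3 := MeasurableEquiv.piCongrLeft_apply_apply (β := fun _ => Measure Ω) (Nat.divModEquiv m) κ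
    (j * m + i)
  rw [show (Nat.divModEquiv m) (j * m + i) = (j, i) from
    (Nat.divModEquiv m).apply_symm_apply (j, i)] at h3
  exact h3.symm

/-- Hoeffding's inequality for the averages of a statistic with values in `[0, 1]`. -/
theorem measureReal_le_abs_average_sub_le {X : Type*} [MeasurableSpace X] (P : Measure X)
    [IsProbabilityMeasure P] {g : X → ℝ} (hg : Measurable g) (h0 : ∀ x, 0 ≤ g x)
    (h1 : ∀ x, g x ≤ 1) (b : ℕ) {δ : ℝ} (hδ : 0 ≤ δ) :
    (Measure.infinitePi fun _ : ℕ => P).real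
      {ω | δ ≤ |(∑ j ∈ Finset.range b, g (ω j)) / b - ∫ x, g x ∂P|} ≤
      2 * Real.exp (-(2 * δ ^ 2 * b)) := by
  rcases Nat.eq_zero_or_pos b with rfl | hb
  · refine measureReal_le_one.trans ?_
    norm_num
  have hb' : (0 : ℝ) < b := by exact_mod_cast hb
  set Q := Measure.infinitePi fun _ : ℕ => P with hQ
  set e := ∫ x, g x ∂P with he
  have hsub : HasSubgaussianMGF (fun x => g x - e) ((‖(1 : ℝ) - 0‖₊ / 2) ^ 2) P :=
    hasSubgaussianMGF_of_mem_Icc hg.aemeasurable (ae_of_all _ fun x => ⟨h0 x, h1 x⟩)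
  -- The sign `s` treats both tails at once; the sub-Gaussian parameter equals `1/4`.
  have hsub' : ∀ s : ℝ, s = 1 ∨ s = -1 → ∀ j : ℕ,
      HasSubgaussianMGF (fun ω : ℕ → X => s * (g (ω j) - e)) ((‖(1 : ℝ) - 0‖₊ / 2) ^ 2) Q := by
    intro s hs j
    have hmap : Q.map (fun ω => ω j) = P := Measure.infinitePi_map_eval _ j
    have h := HasSubgaussianMGF.of_map (μ := Q) (Y := fun ω : ℕ → X => ω j)
      (measurable_pi_apply j).aemeasurable (hmap ▸ hsub)
    rcases hs with rfl | rfl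
    · simpa [Function.comp_def] using h
    · simpa [Pi.neg_def, Function.comp_def] using h.neg
  have hind : ∀ s : ℝ, iIndepFun (fun (j : ℕ) (ω : ℕ → X) => s * (g (ω j) - e)) Q := fun s =>
    iIndepFun_infinitePi (P := fun _ : ℕ => P) (X := fun _ x => s * (g x - e))
      fun _ => (hg.sub_const _).const_mul _
  have hH : ∀ s : ℝ, s = 1 ∨ s = -1 →
      Q.real {ω | b * δ ≤ ∑ j ∈ Finset.range b, s * (g (ω j) - e)} ≤
        Real.exp (-(2 * δ ^ 2 * b)) := by
    intro s hs
    refine (HasSubgaussianMGF.measure_sum_range_ge_le_of_iIndepFun (hind s)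
      (fun j _ => hsub' s hs j) (by positivity)).trans (le_of_eq ?_)
    congr 1
    simp
    field_simp
  have hincl : {ω : ℕ → X | δ ≤ |(∑ j ∈ Finset.range b, g (ω j)) / b - e|} ⊆
      {ω | b * δ ≤ ∑ j ∈ Finset.range b, 1 * (g (ω j) - e)} ∪
      {ω | b * δ ≤ ∑ j ∈ Finset.range b, -1 * (g (ω j) - e)} := by
    intro ω hω
    simp only [Set.mem_ofPred_eq, Set.mem_union] at hω ⊢
    rw [← Finset.mul_sum, ← Finset.mul_sum, Finset.sum_sub_distrib, Finset.sum_const,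
      Finset.card_range, nsmul_eq_mul]
    have : (∑ j ∈ Finset.range b, g (ω j)) / b - e = (∑ j ∈ Finset.range b, g (ω j) - b * e) / b := by
      field_simp
    rw [this, abs_div, abs_of_pos hb', le_div_iff₀ hb'] at hω
    rcases le_abs.1 hω with h | h
    · left; linarith
    · right; linarith
  calc _ ≤ _ := measureReal_mono hincl
    _ ≤ _ := measureReal_union_le _ _
    _ ≤ _ := add_le_add (hH 1 (Or.inl rfl)) (hH (-1) (Or.inr rfl))
    _ = _ := by ring

end Blocks

/-! ### Nonrandomized tests with given error bounds -/

section ErrorBounds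

variable {Ω : Type*} [MeasurableSpace Ω]

/-- The tests `K_n` are nonrandomized and their error probabilities are at most `ε n`. -/
structure HasErrorBound (K : ∀ n, PoissonTest Ω n) (ε : ℕ → ℝ≥0∞)
    (Θ₀ Θ₁ : Set (FiniteMeasure Ω)) : Prop where
  nonrandomized : ∀ n κ, (K n).toFun κ = 0 ∨ (K n).toFun κ = 1
  accepts : ∀ n, ∀ μ ∈ Θ₀, sequenceLaw μ {κ | decision K n κ ≠ 0} ≤ ε n
  rejects : ∀ n, ∀ μ ∈ Θ₁, sequenceLaw μ {κ | decision K n κ ≠ 1} ≤ ε n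

theorem measurable_decision (K : ∀ n, PoissonTest Ω n) (n : ℕ) : Measurable (decision K n) :=
  (K n).measurable_toFun.comp (measurable_pi_lambda _ fun _ => measurable_pi_apply _)

/-- The test that rejects when `A` does not occur. -/
def PoissonTest.ofSet {n : ℕ} (A : Set (Fin n → Measure Ω)) (hA : MeasurableSet A) :
    PoissonTest Ω n where
  toFun := Aᶜ.indicator fun _ => 1
  measurable_toFun := measurable_const.indicator hA.compl
  nonneg κ := Set.indicator_nonneg (fun _ _ => zero_le_one) κ
  le_one κ := Set.indicator_le_self' (fun _ _ => zero_le_one) κ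

theorem PoissonTest.ofSet_eq_zero {n : ℕ} {A : Set (Fin n → Measure Ω)} (hA : MeasurableSet A)
    {κ : Fin n → Measure Ω} : (PoissonTest.ofSet A hA).toFun κ = 0 ↔ κ ∈ A := by
  simp [PoissonTest.ofSet]

theorem PoissonTest.ofSet_eq_one {n : ℕ} {A : Set (Fin n → Measure Ω)} (hA : MeasurableSet A)
    {κ : Fin n → Measure Ω} : (PoissonTest.ofSet A hA).toFun κ = 1 ↔ κ ∉ A := by
  simp [PoissonTest.ofSet]

theorem add_mul_lt_of_lt_div {n m j i : ℕ} (hj : j < n / m) (hi : i < m) : j * m + i < n :=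
  calc j * m + i < j * m + m := Nat.add_lt_add_left hi _
    _ = (j + 1) * m := (Nat.succ_mul j m).symm
    _ ≤ n / m * m := Nat.mul_le_mul_right m hj
    _ ≤ n := Nat.div_mul_le_self n m

/-- The averages of the statistics `g` over the consecutive blocks of `m` observations. -/
def blockAverage {k m : ℕ} (g : Fin k → (Fin m → Measure Ω) → ℝ) (n : ℕ)
    (κ : Fin n → Measure Ω) (i : Fin k) : ℝ :=
  (∑ j : Fin (n / m), g i fun l => κ ⟨j * m + l, add_mul_lt_of_lt_div j.2 l.2⟩) / (n / m : ℕ)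

theorem measurable_blockAverage {k m : ℕ} {g : Fin k → (Fin m → Measure Ω) → ℝ}
    (hg : ∀ i, Measurable (g i)) (n : ℕ) : Measurable (blockAverage g n) := by
  refine measurable_pi_lambda _ fun i => Measurable.div_const ?_ _
  exact Finset.measurable_sum _ fun j _ => (hg i).comp
    (measurable_pi_lambda _ fun l => measurable_pi_apply _)

theorem measure_exists_le_abs_blockAverage_sub_le {k m : ℕ} [NeZero m]
    {g : Fin k → (Fin m → Measure Ω) → ℝ} (hg : ∀ i, Measurable (g i)) (h0 : ∀ i κ, 0 ≤ g i κ)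
    (h1 : ∀ i κ, g i κ ≤ 1) {δ : ℝ} (hδ : 0 ≤ δ) (μ : FiniteMeasure Ω) (n : ℕ) :
    sequenceLaw μ {κ | ∃ i, δ ≤ |blockAverage g n (fun l => κ l) i -
      ∫ x, g i x ∂(sampleLaw μ m)|} ≤
      ENNReal.ofReal (2 * k * Real.exp (2 * δ ^ 2) * Real.exp (-(2 * δ ^ 2 / m) * n)) := by
  have hm : (0 : ℝ) < m := by exact_mod_cast Nat.pos_of_neZero m
  set S : Fin k → Set (ℕ → Fin m → Measure Ω) := fun i =>
    {ω | δ ≤ |(∑ j ∈ Finset.range (n / m), g i (ω j)) / (n / m : ℕ) -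
      ∫ x, g i x ∂(sampleLaw μ m)|} with hS
  have hSm : ∀ i, MeasurableSet (S i) := fun i => by
    refine measurableSet_le measurable_const (Measurable.abs ?_)
    exact ((Finset.measurable_sum _ fun j _ => (hg i).comp (measurable_pi_apply j)).div_const
      _).sub_const _
  have hblock : Measurable fun (κ : ℕ → Measure Ω) (j : ℕ) (i : Fin m) => κ (j * m + i) := by
    fun_prop
  have hset : {κ : ℕ → Measure Ω | ∃ i, δ ≤ |blockAverage g n (fun l => κ l) i -
      ∫ x, g i x ∂(sampleLaw μ m)|} =
      ⋃ i, (fun (κ : ℕ → Measure Ω) (j : ℕ) (i : Fin m) => κ (j * m + i)) ⁻¹' S i := by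
    ext κ
    simp only [Set.mem_ofPred_eq, Set.mem_iUnion, Set.mem_preimage, hS, blockAverage]
    refine exists_congr fun i => ?_
    rw [Fin.sum_univ_eq_sum_range (fun j => g i fun l : Fin m => κ (j * m + l))]
  have hi : ∀ i, sequenceLaw μ
      ((fun (κ : ℕ → Measure Ω) (j : ℕ) (i : Fin m) => κ (j * m + i)) ⁻¹' S i) ≤
      ENNReal.ofReal (2 * Real.exp (2 * δ ^ 2) * Real.exp (-(2 * δ ^ 2 / m) * n)) := by
    intro i
    rw [← Measure.map_apply hblock (hSm i), map_blocks_sequenceLaw, ← ofReal_measureReal]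
    refine ENNReal.ofReal_le_ofReal ((measureReal_le_abs_average_sub_le (sampleLaw μ m) (hg i)
      (h0 i) (h1 i) (n / m) hδ).trans ?_)
    rw [mul_assoc 2 (Real.exp _), ← Real.exp_add]
    refine mul_le_mul_of_nonneg_left (Real.exp_le_exp.2 ?_) zero_le_two
    -- Rounding loses at most one block, which costs the factor `exp (2 δ ^ 2)`.
    have h2 : (n : ℝ) ≤ m * ((n / m : ℕ) + 1) := by
      exact_mod_cast (Nat.lt_mul_div_succ n (Nat.pos_of_neZero m)).le
    have h3 : (n : ℝ) / m ≤ (n / m : ℕ) + 1 := by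
      rw [div_le_iff₀ hm]; linarith
    have h4 := mul_le_mul_of_nonneg_left h3 (show 0 ≤ 2 * δ ^ 2 by positivity)
    have h5 : -(2 * δ ^ 2 / m) * n = -(2 * δ ^ 2 * (n / m)) := by ring
    rw [h5]
    linarith
  rw [hset]
  refine (measure_iUnion_fintype_le _ _).trans ?_
  calc _ ≤ ∑ _i : Fin k, ENNReal.ofReal
        (2 * Real.exp (2 * δ ^ 2) * Real.exp (-(2 * δ ^ 2 / m) * n)) :=
        Finset.sum_le_sum fun i _ => hi i
    _ = _ := by
      rw [Finset.sum_const, Finset.card_univ, Fintype.card_fin, nsmul_eq_mul,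
        ← ENNReal.ofReal_natCast, ← ENNReal.ofReal_mul (by positivity)]
      congr 1
      ring

/-- If finitely many bounded statistics have uniformly separated mean vectors under the two
hypotheses, then there are nonrandomized tests with exponentially small error probabilities. -/
theorem exists_hasErrorBound_of_separated {Θ₀ Θ₁ : Set (FiniteMeasure Ω)} {k m : ℕ} (hm : m ≠ 0)
    {g : Fin k → (Fin m → Measure Ω) → ℝ} (hg : ∀ i, Measurable (g i)) (h0 : ∀ i κ, 0 ≤ g i κ)
    (h1 : ∀ i κ, g i κ ≤ 1) {η : ℝ} (hη : 0 < η)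
    (hsep : ∀ μ ∈ Θ₀, ∀ ν ∈ Θ₁, ∃ i, η ≤ |∫ x, g i x ∂(sampleLaw μ m) -
      ∫ x, g i x ∂(sampleLaw ν m)|) :
    ∃ (K : ∀ n, PoissonTest Ω n) (A c : ℝ), 0 < c ∧
      HasErrorBound K (fun n => ENNReal.ofReal (A * Real.exp (-c * n))) Θ₀ Θ₁ := by
  have : NeZero m := ⟨hm⟩
  -- The test accepts when the block averages lie within `η / 2` of `V`. A wrong decision then
  -- forces some average to deviate from its mean by at least `η / 2`.
  set V : Set (Fin k → ℝ) := (fun μ i => ∫ x, g i x ∂(sampleLaw μ m)) '' Θ₀ with hV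
  have hA : ∀ n, MeasurableSet (blockAverage g n ⁻¹' Metric.thickening (η / 2) V) := fun n =>
    measurable_blockAverage hg n Metric.isOpen_thickening.measurableSet
  have hm0 : (0 : ℝ) < m := by exact_mod_cast Nat.pos_of_neZero m
  refine ⟨fun n => PoissonTest.ofSet _ (hA n), 2 * k * Real.exp (2 * (η / 2) ^ 2),
    2 * (η / 2) ^ 2 / m, by positivity, ?_, ?_, ?_⟩
  · intro n κ
    rw [PoissonTest.ofSet_eq_zero, PoissonTest.ofSet_eq_one]
    exact em _
  · intro n μ hμ
    refine (measure_mono ?_).trans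
      (measure_exists_le_abs_blockAverage_sub_le hg h0 h1 (half_pos hη).le μ n)
    intro κ hκ
    simp only [Set.mem_ofPred_eq, decision, ne_eq, PoissonTest.ofSet_eq_zero, Set.mem_preimage] at hκ ⊢
    by_contra! hcon
    refine hκ (Metric.mem_thickening_iff.2 ⟨_, ⟨μ, hμ, rfl⟩, ?_⟩)
    exact (dist_pi_lt_iff (half_pos hη)).2 hcon
  · intro n ν hν
    refine (measure_mono ?_).trans
      (measure_exists_le_abs_blockAverage_sub_le hg h0 h1 (half_pos hη).le ν n)
    intro κ hκ
    simp only [Set.mem_ofPred_eq, decision, ne_eq, PoissonTest.ofSet_eq_one, Set.mem_preimage,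
      not_not] at hκ ⊢
    obtain ⟨_, ⟨μ, hμ, rfl⟩, hdist⟩ := Metric.mem_thickening_iff.1 hκ
    obtain ⟨i, hi⟩ := hsep μ hμ ν hν
    refine ⟨i, ?_⟩
    have h2 := (dist_pi_lt_iff (half_pos hη)).1 hdist i
    rw [Real.dist_eq, abs_sub_comm] at h2
    have h3 := abs_sub_le (∫ x, g i x ∂(sampleLaw μ m)) (blockAverage g n (fun l => κ l) i)
      (∫ x, g i x ∂(sampleLaw ν m))
    linarith

theorem HasErrorBound.integral_accepts {K : ∀ n, PoissonTest Ω n} {ε : ℕ → ℝ≥0∞}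
    {Θ₀ Θ₁ : Set (FiniteMeasure Ω)} (h : HasErrorBound K ε Θ₀ Θ₁) {n : ℕ} {a : ℝ} (ha : 0 ≤ a)
    (hε : ε n ≤ ENNReal.ofReal a) : typeI (K n) Θ₀ ≤ a ∧ typeII (K n) Θ₁ ≤ a := by
  have hrestr : Measurable fun (κ : ℕ → Measure Ω) (i : Fin n) => κ i := by fun_prop
  have hbound : ∀ (μ : FiniteMeasure Ω) (f : (Fin n → Measure Ω) → ℝ), Measurable f →
      (∀ κ, f κ = 0 ∨ f κ = 1) → sequenceLaw μ {κ | f (fun i => κ i) ≠ 0} ≤ ε n →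
      ∫ κ, f κ ∂(sampleLaw μ n) ≤ a := by
    intro μ f hf h01 hμ
    have hset : MeasurableSet {κ | f κ ≠ 0} := (hf (measurableSet_singleton 0)).compl
    have : f = {κ | f κ ≠ 0}.indicator 1 := by
      ext κ
      rcases h01 κ with h | h <;> simp [h]
    rw [this, integral_indicator_one hset, ← map_restrict_sequenceLaw,
      map_measureReal_apply hrestr hset]
    exact ENNReal.toReal_le_of_le_ofReal ha (hμ.trans hε)
  constructor
  · exact Real.iSup_le (fun μ => hbound μ.1 _ (K n).measurable_toFun (h.nonrandomized n)
      (h.accepts n μ.1 μ.2)) ha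
  · refine Real.iSup_le (fun μ => hbound μ.1 (fun κ => 1 - (K n).toFun κ)
      (measurable_const.sub (K n).measurable_toFun) (fun κ => ?_) ?_) ha
    · rcases h.nonrandomized n κ with h | h <;> simp [h]
    · refine (measure_mono ?_).trans (h.rejects n μ.1 μ.2)
      intro κ hκ hκ'
      exact hκ (sub_eq_zero.2 hκ'.symm)

theorem HasErrorBound.exponentiallyDistinguishable {K : ∀ n, PoissonTest Ω n} {A c : ℝ}
    {Θ₀ Θ₁ : Set (FiniteMeasure Ω)} (hc : 0 < c)
    (h : HasErrorBound K (fun n => ENNReal.ofReal (A * Real.exp (-c * n))) Θ₀ Θ₁) :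
    ExponentiallyDistinguishable Θ₀ Θ₁ := by
  -- Half of the rate is spent on absorbing the constant `A`.
  have hlim : Tendsto (fun n : ℕ => c / 2 * (n : ℝ)) atTop atTop :=
    tendsto_natCast_atTop_atTop.const_mul_atTop (half_pos hc)
  obtain ⟨n₀, hn₀⟩ := eventually_atTop.1
    ((Real.tendsto_exp_atTop.comp hlim).eventually_ge_atTop A)
  refine ⟨K, c / 2, n₀, half_pos hc, fun n hn => h.integral_accepts (Real.exp_pos _).le ?_⟩
  refine ENNReal.ofReal_le_ofReal ?_
  calc A * Real.exp (-c * n) ≤ Real.exp (c / 2 * n) * Real.exp (-c * n) := by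
        gcongr
        exact hn₀ n hn.le
    _ = Real.exp (-(c / 2) * n) := by rw [← Real.exp_add]; ring_nf

theorem ExponentiallyDistinguishable.distinguishable {Θ₀ Θ₁ : Set (FiniteMeasure Ω)}
    (h : ExponentiallyDistinguishable Θ₀ Θ₁) : Distinguishable Θ₀ Θ₁ := by
  obtain ⟨K, c, n₀, hc, hK⟩ := h
  intro a ha _
  have hlim : Tendsto (fun n : ℕ => Real.exp (-c * n)) atTop (𝓝 0) := by
    refine Real.tendsto_exp_atBot.comp ?_
    exact tendsto_natCast_atTop_atTop.const_mul_atTop_of_neg (neg_lt_zero.2 hc)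
  obtain ⟨n₁, hn₁⟩ := eventually_atTop.1 (hlim.eventually_lt_const ha)
  -- The level must be respected for every `n`; small samples get the test that always accepts.
  refine ⟨fun n => if n₀ < n ∧ n₁ ≤ n then K n else PoissonTest.ofSet Set.univ MeasurableSet.univ,
    fun n => ?_, ?_⟩
  · beta_reduce
    by_cases hn : n₀ < n ∧ n₁ ≤ n
    · rw [if_pos hn]
      exact (hK n hn.1).1.trans_lt (hn₁ n hn.2)
    · rw [if_neg hn]
      refine lt_of_le_of_lt (Real.iSup_le (fun μ => le_of_eq ?_) le_rfl) ha
      simp [PoissonTest.ofSet]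
  · refine squeeze_zero' (Eventually.of_forall fun n => typeII_nonneg _ _) ?_ hlim
    filter_upwards [eventually_gt_atTop n₀, eventually_ge_atTop n₁] with n h0 h1
    rw [if_pos ⟨h0, h1⟩]
    exact (hK n h0).2

end ErrorBounds

/-! ### Discernibility -/

/-- One plus the last index with property `p` if there is such a last index, and `0` otherwise. -/
def lastTime (p : ℕ → Prop) : ℝ :=
  open Classical in (⨆ n : ℕ, if p n then ((n : ℝ≥0∞) + 1) else 0).toReal

theorem lastTime_nonneg (p : ℕ → Prop) : 0 ≤ lastTime p := ENNReal.toReal_nonneg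

/-- Valid without exception, because an infinite supremum is sent to `0` by `toReal`; the tail and
moment bounds therefore need no null set. In `le_lastTime`, by contrast, this default makes
finiteness a necessary hypothesis. -/
theorem lastTime_eq_zero_or (p : ℕ → Prop) : lastTime p = 0 ∨ ∃ j, p j ∧ lastTime p = j + 1 := by
  classical
  unfold lastTime
  by_cases hfin : {n | p n}.Finite
  · rcases Set.eq_empty_or_nonempty {n | p n} with he | hne
    · left
      have : ∀ n, ¬ p n := fun n hn => (Set.eq_empty_iff_forall_notMem.1 he) n hn
      simp [this]
    · right
      obtain ⟨j, hj, hmax⟩ := hfin.exists_maximalFor id _ hne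
      refine ⟨j, hj, ?_⟩
      have : (⨆ n : ℕ, if p n then ((n : ℝ≥0∞) + 1) else 0) = (j : ℝ≥0∞) + 1 := by
        refine le_antisymm (iSup_le fun n => ?_) ?_
        · split_ifs with hn
          · have : n ≤ j := by
              by_contra! h
              exact absurd (hmax hn h.le) (not_le.2 h)
            gcongr
          · exact zero_le
        · refine le_iSup_of_le j ?_
          rw [if_pos (show p j from hj)]
      rw [this, ENNReal.toReal_add (by simp) (by simp)]
      simp
  · left
    have : (⨆ n : ℕ, if p n then ((n : ℝ≥0∞) + 1) else 0) = ⊤ := by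
      refine ENNReal.eq_top_of_forall_nnreal_le fun r => ?_
      obtain ⟨k, hk⟩ := exists_nat_ge r
      obtain ⟨n, hn, hkn⟩ := (Set.infinite_of_not_bddAbove fun h =>
        hfin (h.finite)).exists_gt k
      refine le_iSup_of_le n ?_
      rw [if_pos (show p n from hn)]
      calc (r : ℝ≥0∞) ≤ (k : ℝ≥0∞) := by exact_mod_cast hk
        _ ≤ (n : ℝ≥0∞) := by exact_mod_cast hkn.le
        _ ≤ _ := le_self_add
    rw [this, ENNReal.toReal_top]

theorem le_lastTime {p : ℕ → Prop} (h : ∀ᶠ n in atTop, ¬ p n) {k : ℕ} (hk : p k) :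
    (k : ℝ) + 1 ≤ lastTime p := by
  classical
  unfold lastTime
  obtain ⟨a, ha⟩ := eventually_atTop.1 h
  have hle : (⨆ n : ℕ, if p n then ((n : ℝ≥0∞) + 1) else 0) ≤ (a : ℝ≥0∞) + 1 := by
    refine iSup_le fun n => ?_
    split_ifs with hn
    · have : n ≤ a := by
        by_contra! h
        exact ha n h.le hn
      gcongr
    · exact zero_le
  have h1 : (k : ℝ≥0∞) + 1 ≤ ⨆ n : ℕ, if p n then ((n : ℝ≥0∞) + 1) else 0 :=
    le_iSup_of_le k (by rw [if_pos hk])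
  have := ENNReal.toReal_mono (ne_top_of_le_ne_top (by simp) hle) h1
  rwa [ENNReal.toReal_add (by simp) (by simp), ENNReal.toReal_natCast, ENNReal.toReal_one] at this

section Discernibility

variable {Ω : Type*} [MeasurableSpace Ω]

/-- Two plus the last index `n` for which the decisions of `K n` and `K (n + 1)` differ. -/
def stabilizationTime (K : ∀ n, PoissonTest Ω n) (κ : ℕ → Measure Ω) : ℝ :=
  1 + lastTime fun n => decision K n κ ≠ decision K (n + 1) κ

theorem measurableSet_decision_ne (K : ∀ n, PoissonTest Ω n) (n : ℕ) :
    MeasurableSet {κ | decision K n κ ≠ decision K (n + 1) κ} :=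
  (measurableSet_eq_fun (measurable_decision K n) (measurable_decision K (n + 1))).compl

theorem measurable_stabilizationTime (K : ∀ n, PoissonTest Ω n) :
    Measurable (stabilizationTime K) := by
  classical
  unfold stabilizationTime lastTime
  refine measurable_const.add (ENNReal.measurable_toReal.comp (Measurable.iSup fun n => ?_))
  exact Measurable.ite (measurableSet_decision_ne K n) measurable_const measurable_const

theorem decision_eq_of_stabilizationTime_lt {K : ∀ n, PoissonTest Ω n} {κ : ℕ → Measure Ω} {x : ℝ}
    (h : ∀ᶠ n in atTop, decision K n κ = x) {n : ℕ} (hn : stabilizationTime K κ < n) :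
    decision K n κ = x := by
  have hev : ∀ᶠ n in atTop, ¬ decision K n κ ≠ decision K (n + 1) κ := by
    filter_upwards [h, (tendsto_add_atTop_nat 1).eventually h] with n h1 h2
    rw [h1, h2, not_not]
  have hstep : ∀ k, n ≤ k → decision K n κ = decision K k κ := by
    intro k hk
    induction k, hk using Nat.le_induction with
    | base => rfl
    | succ k hk ih =>
      rw [ih]
      by_contra hne
      have h1 := le_lastTime hev hne
      have h2 : (n : ℝ) ≤ k := by exact_mod_cast hk
      unfold stabilizationTime at hn
      linarith
  obtain ⟨k, hk, hx⟩ := ((eventually_ge_atTop n).and h).exists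
  rw [hstep k hk, hx]

theorem HasErrorBound.measure_decision_ne_le {K : ∀ n, PoissonTest Ω n} {ε : ℕ → ℝ≥0∞}
    {Θ₀ Θ₁ : Set (FiniteMeasure Ω)} (h : HasErrorBound K ε Θ₀ Θ₁) {μ : FiniteMeasure Ω}
    (hμ : μ ∈ Θ₀ ∪ Θ₁) (n : ℕ) :
    sequenceLaw μ {κ | decision K n κ ≠ decision K (n + 1) κ} ≤ ε n + ε (n + 1) := by
  have key : ∀ x : ℝ, (∀ n, sequenceLaw μ {κ | decision K n κ ≠ x} ≤ ε n) →
      sequenceLaw μ {κ | decision K n κ ≠ decision K (n + 1) κ} ≤ ε n + ε (n + 1) := by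
    intro x hx
    refine (measure_mono ?_).trans ((measure_union_le _ _).trans (add_le_add (hx n) (hx (n + 1))))
    intro κ hκ
    by_contra hcon
    simp only [Set.mem_union, Set.mem_ofPred_eq, not_or, not_not] at hcon
    exact hκ (hcon.1.trans hcon.2.symm)
  rcases hμ with hμ | hμ
  · exact key 0 fun n => h.accepts n μ hμ
  · exact key 1 fun n => h.rejects n μ hμ

/-- By Borel–Cantelli the decisions are almost surely correct eventually, and after the
stabilization time they already equal their eventual value. -/
theorem HasErrorBound.discernsAfter {K : ∀ n, PoissonTest Ω n} {ε : ℕ → ℝ≥0∞}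
    {Θ₀ Θ₁ : Set (FiniteMeasure Ω)} (h : HasErrorBound K ε Θ₀ Θ₁) (hε : ∑' n, ε n ≠ ⊤) :
    DiscernsAfter K (stabilizationTime K) Θ₀ Θ₁ := by
  have key : ∀ (μ : FiniteMeasure Ω) (x : ℝ),
      (∀ n, sequenceLaw μ {κ | decision K n κ ≠ x} ≤ ε n) →
      ∀ᵐ κ ∂(sequenceLaw μ), ∀ n : ℕ, stabilizationTime K κ < n → decision K n κ = x := by
    intro μ x hx
    filter_upwards [ae_eventually_notMem (ne_top_of_le_ne_top hε (ENNReal.tsum_le_tsum hx))]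
      with κ hκ n hn
    exact decision_eq_of_stabilizationTime_lt (hκ.mono fun n hn => not_not.1 hn) hn
  exact ⟨h.nonrandomized, measurable_stabilizationTime K,
    fun κ => add_pos_of_pos_of_nonneg one_pos (lastTime_nonneg _),
    fun μ hμ => key μ 0 fun n => h.accepts n μ hμ, fun μ hμ => key μ 1 fun n => h.rejects n μ hμ⟩

theorem HasErrorBound.uniformlyBounded {K : ∀ n, PoissonTest Ω n} {ε : ℕ → ℝ≥0∞}
    {Θ₀ Θ₁ : Set (FiniteMeasure Ω)} (h : HasErrorBound K ε Θ₀ Θ₁) (hε : ∑' n, ε n ≠ ⊤) :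
    UniformlyBounded (stabilizationTime K) Θ₀ Θ₁ := by
  have hsum : ∑' n, (ε n + ε (n + 1)) ≠ ⊤ := by
    rw [ENNReal.tsum_add]
    refine ENNReal.add_ne_top.2 ⟨hε, ne_top_of_le_ne_top hε ?_⟩
    exact ENNReal.tsum_comp_le_tsum_of_injective (add_left_injective 1) ε
  have htail := ENNReal.tendsto_sum_nat_add _ hsum
  unfold UniformlyBounded
  rw [ENNReal.tendsto_nhds_zero] at htail ⊢
  intro δ hδ
  obtain ⟨J, hJ⟩ := (htail δ hδ).exists
  -- A last change at `j` gives the time `j + 2`, which exceeds `C ≥ J + 1` only if `j ≥ J`.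
  filter_upwards [eventually_ge_atTop ((J : ℝ) + 1)] with C hC
  refine (iSup₂_le fun μ hμ => ?_).trans hJ
  refine (measure_mono (t := ⋃ k : ℕ, {κ | decision K (k + J) κ ≠ decision K (k + J + 1) κ})
    fun κ hκ => ?_).trans ((measure_iUnion_le _).trans
      (ENNReal.tsum_le_tsum fun k => h.measure_decision_ne_le hμ (k + J)))
  have hκ' : C < 1 + lastTime fun n => decision K n κ ≠ decision K (n + 1) κ := hκ
  rcases lastTime_eq_zero_or fun n => decision K n κ ≠ decision K (n + 1) κ with h0 | ⟨j, hj, hj'⟩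
  · rw [h0] at hκ'
    have : (0 : ℝ) ≤ J := J.cast_nonneg
    linarith
  · rw [hj'] at hκ'
    have hJj : J ≤ j := by
      have : (J : ℝ) < j + 1 := by linarith
      exact Nat.lt_succ_iff.1 (by exact_mod_cast this)
    refine Set.mem_iUnion.2 ⟨j - J, ?_⟩
    rw [Nat.sub_add_cancel hJj]
    exact hj

theorem HasErrorBound.uniformlyDiscerns {K : ∀ n, PoissonTest Ω n} {ε : ℕ → ℝ≥0∞}
    {Θ₀ Θ₁ : Set (FiniteMeasure Ω)} (h : HasErrorBound K ε Θ₀ Θ₁) (hε : ∑' n, ε n ≠ ⊤) :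
    UniformlyDiscerns K Θ₀ Θ₁ :=
  ⟨_, h.discernsAfter hε, h.uniformlyBounded hε⟩

/-- Pointwise, the exponential is either `exp t` (no last change) or the term `exp (t (j + 2))` of
the last change `j`, hence at most the sum over all changes. -/
theorem HasErrorBound.lintegral_exp_stabilizationTime_le {K : ∀ n, PoissonTest Ω n}
    {ε : ℕ → ℝ≥0∞} {Θ₀ Θ₁ : Set (FiniteMeasure Ω)} (h : HasErrorBound K ε Θ₀ Θ₁)
    {μ : FiniteMeasure Ω} (hμ : μ ∈ Θ₀ ∪ Θ₁) (t : ℝ) :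
    ∫⁻ κ, ENNReal.ofReal (Real.exp (t * stabilizationTime K κ)) ∂(sequenceLaw μ) ≤
      ENNReal.ofReal (Real.exp t) +
        ∑' j : ℕ, ENNReal.ofReal (Real.exp (t * (j + 2))) * (ε j + ε (j + 1)) := by
  set D : ℕ → Set (ℕ → Measure Ω) := fun j => {κ | decision K j κ ≠ decision K (j + 1) κ} with hD
  have hDm : ∀ j, MeasurableSet (D j) := measurableSet_decision_ne K
  calc _ ≤ ∫⁻ κ, (ENNReal.ofReal (Real.exp t) +
        ∑' j : ℕ, (D j).indicator (fun _ => ENNReal.ofReal (Real.exp (t * (j + 2)))) κ)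
          ∂(sequenceLaw μ) := by
        refine lintegral_mono fun κ => ?_
        rcases lastTime_eq_zero_or fun n => decision K n κ ≠ decision K (n + 1) κ with
          h0 | ⟨j, hj, hj'⟩
        · refine le_add_right (le_of_eq ?_)
          rw [stabilizationTime, h0, add_zero, mul_one]
        · refine le_add_left (le_trans (le_of_eq ?_) (ENNReal.le_tsum j))
          rw [Set.indicator_of_mem (show κ ∈ D j from hj), stabilizationTime, hj']
          ring_nf
    _ = ENNReal.ofReal (Real.exp t) +
        ∑' j : ℕ, ENNReal.ofReal (Real.exp (t * (j + 2))) * sequenceLaw μ (D j) := by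
        rw [lintegral_add_left measurable_const, lintegral_const, measure_univ, mul_one,
          lintegral_tsum fun j => (measurable_const.indicator (hDm j)).aemeasurable]
        simp_rw [lintegral_indicator_const (hDm _)]
    _ ≤ _ := by
        gcongr with j
        exact h.measure_decision_ne_le hμ j

theorem tsum_ofReal_mul_exp_ne_top (A : ℝ) {c : ℝ} (hc : 0 < c) :
    ∑' n : ℕ, ENNReal.ofReal (A * Real.exp (-c * n)) ≠ ⊤ := by
  have hs : Summable fun n : ℕ => |A| * Real.exp (-c * n) := by
    refine Summable.mul_left _ ?_
    simpa [mul_comm] using Real.summable_exp_nat_mul_iff.2 (neg_lt_zero.2 hc)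
  refine ne_top_of_le_ne_top hs.tsum_ofReal_ne_top (ENNReal.tsum_le_tsum fun n => ?_)
  exact ENNReal.ofReal_le_ofReal (mul_le_mul_of_nonneg_right (le_abs_self A) (Real.exp_pos _).le)

theorem HasErrorBound.uniformlyDiscernibleExpMoment {K : ∀ n, PoissonTest Ω n} {A c : ℝ}
    {Θ₀ Θ₁ : Set (FiniteMeasure Ω)} (hc : 0 < c)
    (h : HasErrorBound K (fun n => ENNReal.ofReal (A * Real.exp (-c * n))) Θ₀ Θ₁) :
    UniformlyDiscernibleExpMoment Θ₀ Θ₁ := by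
  have hε := tsum_ofReal_mul_exp_ne_top A hc
  set B : ℝ≥0∞ := ENNReal.ofReal (Real.exp (c / 2)) +
    ∑' j : ℕ, ENNReal.ofReal (2 * |A| * Real.exp c * Real.exp (-(c / 2) * j)) with hB
  have hBtop : B ≠ ⊤ :=
    ENNReal.add_ne_top.2 ⟨ENNReal.ofReal_ne_top, tsum_ofReal_mul_exp_ne_top _ (half_pos hc)⟩
  -- With `t = c / 2` the terms of the moment series still decay like `exp (-(c / 2) j)`; the added
  -- `1` makes the bound strict.
  refine ⟨K, stabilizationTime K, h.discernsAfter hε, h.uniformlyBounded hε, c / 2,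
    B.toNNReal + 1, half_pos hc, ?_⟩
  refine lt_of_le_of_lt (b := B) (iSup₂_le fun μ hμ =>
    (h.lintegral_exp_stabilizationTime_le hμ (c / 2)).trans ?_) ?_
  · rw [hB]
    gcongr with j
    have hle : ∀ k : ℕ, j ≤ k → ENNReal.ofReal (A * Real.exp (-c * k)) ≤
        ENNReal.ofReal (|A| * Real.exp (-c * j)) := fun k hk => by
      have hjk : (j : ℝ) ≤ k := by exact_mod_cast hk
      exact ENNReal.ofReal_le_ofReal (mul_le_mul (le_abs_self A) (Real.exp_le_exp.2 (by nlinarith))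
        (Real.exp_pos _).le (abs_nonneg A))
    calc _ ≤ ENNReal.ofReal (Real.exp (c / 2 * (j + 2))) *
          (ENNReal.ofReal (|A| * Real.exp (-c * j)) + ENNReal.ofReal (|A| * Real.exp (-c * j))) := by
          exact mul_le_mul' le_rfl (add_le_add (hle j le_rfl) (hle (j + 1) j.le_succ))
      _ = _ := by
          rw [← ENNReal.ofReal_add (by positivity) (by positivity),
            ← ENNReal.ofReal_mul (Real.exp_pos _).le]
          congr 1
          have : Real.exp (c / 2 * (j + 2)) * Real.exp (-c * j) =
              Real.exp c * Real.exp (-(c / 2) * j) := by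
            rw [← Real.exp_add, ← Real.exp_add]
            ring_nf
          linear_combination (2 * |A|) * this
  · rw [ENNReal.coe_add, ENNReal.coe_toNNReal hBtop, ENNReal.coe_one]
    exact ENNReal.lt_add_right hBtop one_ne_zero

/-- Distinguishable hypotheses admit nonrandomized tests with exponentially small error
probabilities. -/
theorem Distinguishable.exists_hasErrorBound {Θ₀ Θ₁ : Set (FiniteMeasure Ω)}
    (h : Distinguishable Θ₀ Θ₁) : ∃ (K : ∀ n, PoissonTest Ω n) (A c : ℝ), 0 < c ∧
      HasErrorBound K (fun n => ENNReal.ofReal (A * Real.exp (-c * n))) Θ₀ Θ₁ := by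
  -- At one sample size `m > 0` both errors are below `1/3`, so the means of `K m` differ by at
  -- least `1/3`.
  obtain ⟨K, hα, hβ⟩ := h (1 / 3) (by norm_num) (by norm_num)
  obtain ⟨m, hm, hmβ⟩ := ((eventually_gt_atTop 0).and
    (hβ.eventually_lt_const (show (0 : ℝ) < 1 / 3 by norm_num))).exists
  refine exists_hasErrorBound_of_separated (k := 1) hm.ne' (g := fun _ => (K m).toFun)
    (fun _ => (K m).measurable_toFun) (fun _ => (K m).nonneg) (fun _ => (K m).le_one)
    (show (0 : ℝ) < 1 / 3 by norm_num) fun μ hμ ν hν => ⟨0, ?_⟩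
  have h1 := (integral_le_typeI (K m) hμ).trans (hα m).le
  have h2 := (integral_le_typeII (K m) hν).trans hmβ.le
  rw [(K m).integral_one_sub] at h2
  rw [abs_sub_comm]
  refine le_trans ?_ (le_abs_self _)
  linarith

end Discernibility

/-! ### Separation by the values on finitely many open sets -/

section OpenSets

variable {Ω : Type*} [TopologicalSpace Ω] [MeasurableSpace Ω] [OpensMeasurableSpace Ω]

/-- If the values of two families of finite measures on every open set are asymptotically equal,
then they have the same weak limits. -/
theorem tendsto_of_forall_isOpen_tendsto_sub {ι : Type*} {l : Filter ι}
    {μ ν : ι → FiniteMeasure Ω} {ρ : FiniteMeasure Ω} (hμ : Tendsto μ l (𝓝 ρ))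
    (h : ∀ U, IsOpen U → Tendsto (fun i => (μ i : Measure Ω).real U - (ν i : Measure Ω).real U) l
      (𝓝 0)) : Tendsto ν l (𝓝 ρ) := by
  rw [FiniteMeasure.tendsto_iff_forall_lintegral_tendsto] at hμ ⊢
  intro f
  have hmass : Tendsto (fun i => (μ i : Measure Ω).real Set.univ) l
      (𝓝 ((ρ : Measure Ω).real Set.univ)) := by
    have h1 := (ENNReal.tendsto_toReal (by simp)).comp (hμ 1)
    simpa [Measure.real, Function.comp_def] using h1
  have hmass' : Tendsto (fun i => (ν i : Measure Ω).real Set.univ) l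
      (𝓝 ((ρ : Measure Ω).real Set.univ)) := by
    simpa using hmass.sub (h _ isOpen_univ)
  have hsub := tendsto_integral_sub_of_superlevel (l := l) (a := fun i => (μ i : Measure Ω))
    (b := fun i => (ν i : Measure Ω)) (f := fun x => (f x : ℝ)) (C := nndist f 0)
    (NNReal.continuous_coe.comp f.continuous).measurable (fun x => NNReal.coe_nonneg _)
    (fun x => NNReal.coe_le_coe.2 (BoundedContinuousFunction.NNReal.upper_bound f x))
    (hmass.eventually_le_const (lt_add_one _)) (hmass'.eventually_le_const (lt_add_one _))
    fun m j => h _ (isOpen_lt continuous_const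
      (continuous_const.mul (NNReal.continuous_coe.comp f.continuous)))
  have hreal : ∀ κ : FiniteMeasure Ω, (∫⁻ ω, f ω ∂(κ : Measure Ω)).toReal =
      ∫ ω, (f ω : ℝ) ∂(κ : Measure Ω) := fun κ => by
    rw [lintegral_eq_ofReal_integral, ENNReal.toReal_ofReal]
    exact integral_nonneg fun x => NNReal.coe_nonneg _
  have h1 := (ENNReal.tendsto_toReal
    (BoundedContinuousFunction.lintegral_lt_top_of_nnreal (ρ : Measure Ω) f).ne).comp (hμ f)
  simp only [Function.comp_def, hreal] at h1
  have h2 := h1.sub hsub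
  simp only [sub_sub_cancel, sub_zero] at h2
  simp_rw [lintegral_eq_ofReal_integral]
  exact (ENNReal.continuous_ofReal.tendsto _).comp h2

theorem exists_isOpen_le_abs_sub_of_isCompact {Θ₀ Θ₁ : Set (FiniteMeasure Ω)}
    (hc : IsCompact (closure Θ₀)) (hd : closure Θ₀ ∩ closure Θ₁ = ∅) :
    ∃ (k : ℕ) (B : Fin k → Set Ω) (δ : ℝ), 0 < δ ∧ (∀ i, IsOpen (B i)) ∧
      ∀ μ ∈ Θ₀, ∀ ν ∈ Θ₁, ∃ i, δ ≤ |(μ : Measure Ω).real (B i) - (ν : Measure Ω).real (B i)| := by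
  classical
  by_contra! hcon
  have hpair : ∀ p : Finset (TopologicalSpace.Opens Ω) × ℕ, ∃ q : FiniteMeasure Ω × FiniteMeasure Ω,
      q.1 ∈ Θ₀ ∧ q.2 ∈ Θ₁ ∧ ∀ U ∈ p.1,
        |(q.1 : Measure Ω).real U - (q.2 : Measure Ω).real U| < 1 / (p.2 + 1) := by
    intro p
    obtain ⟨μ, hμ, ν, hν, h⟩ := hcon p.1.card (fun i => (p.1.equivFin.symm i : Set Ω))
      (1 / (p.2 + 1)) (by positivity) fun i => (p.1.equivFin.symm i).1.isOpen
    refine ⟨(μ, ν), hμ, hν, fun U hU => ?_⟩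
    simpa using h (p.1.equivFin ⟨U, hU⟩)
  choose q hq0 hq1 hq using hpair
  set l : Ultrafilter (Finset (TopologicalSpace.Opens Ω) × ℕ) := Ultrafilter.of atTop with hl
  have hle : (l : Filter (Finset (TopologicalSpace.Opens Ω) × ℕ)) ≤ atTop := Ultrafilter.of_le _
  obtain ⟨ρ, hρ, hlim⟩ := hc.ultrafilter_le_nhds' (l.map fun p => (q p).1)
    (Ultrafilter.mem_map.2 (Filter.univ_mem' fun p => subset_closure (hq0 p)))
  have hμ : Tendsto (fun p => (q p).1) l (𝓝 ρ) := hlim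
  have hν : Tendsto (fun p => (q p).2) l (𝓝 ρ) := by
    refine tendsto_of_forall_isOpen_tendsto_sub hμ fun U hU => Tendsto.mono_left ?_ hle
    rw [Metric.tendsto_nhds]
    intro ε hε
    obtain ⟨n, hn⟩ := exists_nat_one_div_lt hε
    filter_upwards [eventually_ge_atTop (({⟨U, hU⟩} : Finset (TopologicalSpace.Opens Ω)), n)]
      with p hp
    rw [Real.dist_0_eq_abs]
    refine (hq p ⟨U, hU⟩ (hp.1 (Finset.mem_singleton_self _))).trans (lt_of_le_of_lt ?_ hn)
    have : (n : ℝ) ≤ p.2 := by exact_mod_cast hp.2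
    gcongr
  have hρ1 : ρ ∈ closure Θ₁ := mem_closure_of_tendsto hν (Eventually.of_forall hq1)
  exact (Set.eq_empty_iff_forall_notMem.1 hd) ρ ⟨hρ, hρ1⟩

/-- If one of two sets of measures with disjoint weak closures is weakly relatively compact, then
finitely many open sets separate them. -/
theorem exists_isOpen_le_abs_sub {Θ₀ Θ₁ : Set (FiniteMeasure Ω)}
    (hc : WeaklyRelativelyCompact Θ₀ ∨ WeaklyRelativelyCompact Θ₁)
    (hd : closure Θ₀ ∩ closure Θ₁ = ∅) :
    ∃ (k : ℕ) (B : Fin k → Set Ω) (δ : ℝ), 0 < δ ∧ (∀ i, IsOpen (B i)) ∧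
      ∀ μ ∈ Θ₀, ∀ ν ∈ Θ₁, ∃ i, δ ≤ |(μ : Measure Ω).real (B i) - (ν : Measure Ω).real (B i)| := by
  rcases hc with hc | hc
  · exact exists_isOpen_le_abs_sub_of_isCompact hc hd
  · obtain ⟨k, B, δ, hδ, hB, h⟩ :=
      exists_isOpen_le_abs_sub_of_isCompact hc (by rwa [Set.inter_comm])
    refine ⟨k, B, δ, hδ, hB, fun μ hμ ν hν => ?_⟩
    obtain ⟨i, hi⟩ := h ν hν μ hμ
    exact ⟨i, by rwa [abs_sub_comm]⟩

theorem exists_isOpen_inter_closure_valueSet_eq_empty {Θ₀ Θ₁ : Set (FiniteMeasure Ω)}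
    (hc : WeaklyRelativelyCompact Θ₀ ∨ WeaklyRelativelyCompact Θ₁)
    (hd : closure Θ₀ ∩ closure Θ₁ = ∅) :
    ∃ (k : ℕ) (B : Fin k → Set Ω), (∀ i, IsOpen (B i)) ∧
      closure (valueSet B Θ₀) ∩ closure (valueSet B Θ₁) = ∅ := by
  obtain ⟨k, B, δ, hδ, hB, h⟩ := exists_isOpen_le_abs_sub hc hd
  refine ⟨k, B, hB, Set.eq_empty_iff_forall_notMem.2 fun v hv => ?_⟩
  obtain ⟨_, ⟨μ, hμ, rfl⟩, hμv⟩ := Metric.mem_closure_iff.1 hv.1 (δ / 2) (half_pos hδ)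
  obtain ⟨_, ⟨ν, hν, rfl⟩, hνv⟩ := Metric.mem_closure_iff.1 hv.2 (δ / 2) (half_pos hδ)
  obtain ⟨i, hi⟩ := h μ hμ ν hν
  have h1 := (dist_pi_lt_iff (half_pos hδ)).1 hμv i
  have h2 := (dist_pi_lt_iff (half_pos hδ)).1 hνv i
  rw [Real.dist_eq, abs_sub_comm] at h1
  rw [Real.dist_eq] at h2
  have h3 := abs_sub_le ((μ : Measure Ω).real (B i)) (v i) ((ν : Measure Ω).real (B i))
  have h1' : |(μ : Measure Ω).real (B i) - v i| < δ / 2 := h1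
  have h2' : |v i - (ν : Measure Ω).real (B i)| < δ / 2 := h2
  linarith

end OpenSets

/-! ### Exponentially distinguishable hypotheses -/

section VoidProbabilities

variable {Ω : Type*} [MeasurableSpace Ω]

/-- The void event requires all `k` points to lie in `Bᶜ`, so the series sums to `exp (μ Bᶜ - μ Ω)`.
Unlike the count `κ B`, its indicator is bounded, as the block averages require. -/
theorem poissonLaw_real_void (μ : FiniteMeasure Ω) {B : Set Ω} (hB : MeasurableSet B) :
    (poissonLaw μ).real {κ | κ B = 0} = Real.exp (-(μ : Measure Ω).real B) := by
  have hm : MeasurableSet {κ : Measure Ω | κ B = 0} :=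
    Measure.measurable_coe hB (measurableSet_singleton 0)
  rw [poissonLaw_real_apply μ hm]
  have hpre : ∀ k : ℕ, pointConfiguration k ⁻¹' {κ : Measure Ω | κ B = 0} =
      Set.univ.pi fun _ : Fin k => Bᶜ := by
    intro k
    ext x
    simp [pointConfiguration, Measure.finsetSum_apply, Measure.dirac_apply' _ hB]
  have hpi : ∀ k : ℕ, (Measure.pi fun _ : Fin k => (μ : Measure Ω)).real
      (pointConfiguration k ⁻¹' {κ : Measure Ω | κ B = 0}) = ((μ : Measure Ω).real Bᶜ) ^ k := by
    intro k
    rw [hpre, Measure.real, Measure.pi_pi, ENNReal.toReal_prod]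
    simp [Measure.real]
  simp_rw [hpi]
  have hs := (NormedSpace.expSeries_div_hasSum_exp ((μ : Measure Ω).real Bᶜ)).mul_left
    (Real.exp (-(μ.mass : ℝ)))
  rw [← Real.exp_eq_exp_ℝ, ← Real.exp_add, measureReal_compl hB] at hs
  have hmass : (μ.mass : ℝ) = (μ : Measure Ω).real Set.univ := rfl
  rw [hmass, show -(μ : Measure Ω).real Set.univ + ((μ : Measure Ω).real Set.univ -
    (μ : Measure Ω).real B) = -(μ : Measure Ω).real B by ring] at hs
  rw [measureReal_compl hB, hmass, ← hs.tsum_eq]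
  exact tsum_congr fun k => by ring

/-- The indicator of the event that the first observed process has no points in `B`. -/
def voidIndicator (B : Set Ω) : (Fin 1 → Measure Ω) → ℝ :=
  {κ : Fin 1 → Measure Ω | κ 0 B = 0}.indicator 1

theorem measurableSet_void {B : Set Ω} (hB : MeasurableSet B) :
    MeasurableSet {κ : Fin 1 → Measure Ω | κ 0 B = 0} :=
  ((Measure.measurable_coe hB).comp (measurable_pi_apply (0 : Fin 1))) (measurableSet_singleton 0)

theorem integral_voidIndicator (μ : FiniteMeasure Ω) {B : Set Ω} (hB : MeasurableSet B) :
    ∫ κ, voidIndicator B κ ∂(sampleLaw μ 1) = Real.exp (-(μ : Measure Ω).real B) := by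
  rw [voidIndicator, integral_indicator_one (measurableSet_void hB), ← poissonLaw_real_void μ hB]
  have h := measurePreserving_eval (fun _ : Fin 1 => poissonLaw μ) 0
  exact h.measureReal_preimage
    (Measure.measurable_coe hB (measurableSet_singleton 0)).nullMeasurableSet

/-- Only `a` has to be bounded, which matters because the masses in just one of the two hypotheses
are known to be bounded. -/
theorem le_abs_exp_neg_sub_exp_neg {M δ a b : ℝ} (ha : a ≤ M) (hab : δ ≤ |a - b|) :
    Real.exp (-M) * (1 - Real.exp (-δ)) ≤ |Real.exp (-a) - Real.exp (-b)| := by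
  by_cases hδ : δ ≤ 0
  · refine le_trans (mul_nonpos_of_nonneg_of_nonpos (Real.exp_pos _).le ?_) (abs_nonneg _)
    have := Real.one_le_exp (neg_nonneg.2 hδ)
    linarith
  push Not at hδ
  have h1 : 0 ≤ 1 - Real.exp (-δ) := by
    have := Real.exp_le_one_iff.2 (neg_nonpos.2 hδ.le)
    linarith
  have h2 : Real.exp (-M) ≤ Real.exp (-a) := Real.exp_le_exp.2 (neg_le_neg ha)
  refine (mul_le_mul_of_nonneg_right h2 h1).trans ?_
  rcases le_abs.1 hab with h | h
  · rw [abs_sub_comm]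
    refine le_trans ?_ (le_abs_self _)
    have h3 : Real.exp (-a) * Real.exp δ ≤ Real.exp (-b) := by
      rw [← Real.exp_add]
      exact Real.exp_le_exp.2 (by linarith)
    have h4 : 1 - Real.exp (-δ) ≤ Real.exp δ - 1 := by
      linarith [Real.add_one_le_exp δ, Real.add_one_le_exp (-δ)]
    nlinarith [Real.exp_pos (-a)]
  · refine le_trans ?_ (le_abs_self _)
    have h3 : Real.exp (-b) ≤ Real.exp (-a) * Real.exp (-δ) := by
      rw [← Real.exp_add]
      exact Real.exp_le_exp.2 (by linarith)
    linarith

theorem WeaklyRelativelyCompact.exists_mass_le [TopologicalSpace Ω] [OpensMeasurableSpace Ω]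
    {Θ : Set (FiniteMeasure Ω)} (h : WeaklyRelativelyCompact Θ) :
    ∃ M : ℝ, ∀ μ ∈ Θ, ∀ B : Set Ω, (μ : Measure Ω).real B ≤ M := by
  obtain ⟨M, hM⟩ := (h.image FiniteMeasure.continuous_mass).bddAbove
  refine ⟨M, fun μ hμ B => (measureReal_mono (Set.subset_univ B)).trans ?_⟩
  exact NNReal.coe_le_coe.2 (hM ⟨μ, subset_closure hμ, rfl⟩)

/-- If one of two sets of measures with disjoint weak closures is weakly relatively compact, then
there are nonrandomized tests with exponentially small error probabilities. -/
theorem exists_hasErrorBound_of_weaklyRelativelyCompact [TopologicalSpace Ω]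
    [OpensMeasurableSpace Ω] {Θ₀ Θ₁ : Set (FiniteMeasure Ω)}
    (hc : WeaklyRelativelyCompact Θ₀ ∨ WeaklyRelativelyCompact Θ₁)
    (hd : closure Θ₀ ∩ closure Θ₁ = ∅) :
    ∃ (K : ∀ n, PoissonTest Ω n) (A c : ℝ), 0 < c ∧
      HasErrorBound K (fun n => ENNReal.ofReal (A * Real.exp (-c * n))) Θ₀ Θ₁ := by
  obtain ⟨k, B, δ, hδ, hB, hgap⟩ := exists_isOpen_le_abs_sub hc hd
  obtain ⟨M, hM⟩ : ∃ M : ℝ, ∀ μ ∈ Θ₀, ∀ ν ∈ Θ₁, ∀ i,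
      (μ : Measure Ω).real (B i) ≤ M ∨ (ν : Measure Ω).real (B i) ≤ M := by
    rcases hc with hc | hc
    · obtain ⟨M, hM⟩ := hc.exists_mass_le
      exact ⟨M, fun μ hμ ν _ i => Or.inl (hM μ hμ _)⟩
    · obtain ⟨M, hM⟩ := hc.exists_mass_le
      exact ⟨M, fun μ _ ν hν i => Or.inr (hM ν hν _)⟩
  have hη : 0 < Real.exp (-M) * (1 - Real.exp (-δ)) :=
    mul_pos (Real.exp_pos _) (sub_pos.2 (Real.exp_lt_one_iff.2 (neg_lt_zero.2 hδ)))
  refine exists_hasErrorBound_of_separated one_ne_zero (g := fun i => voidIndicator (B i))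
    (fun i => measurable_const.indicator (measurableSet_void (hB i).measurableSet))
    (fun i κ => Set.indicator_nonneg (fun _ _ => zero_le_one) κ)
    (fun i κ => Set.indicator_le_self' (fun _ _ => zero_le_one) κ) hη fun μ hμ ν hν => ?_
  obtain ⟨i, hi⟩ := hgap μ hμ ν hν
  refine ⟨i, ?_⟩
  rw [integral_voidIndicator μ (hB i).measurableSet, integral_voidIndicator ν (hB i).measurableSet]
  rcases hM μ hμ ν hν i with h | h
  · exact le_abs_exp_neg_sub_exp_neg h hi
  · rw [abs_sub_comm]
    exact le_abs_exp_neg_sub_exp_neg h (by rwa [abs_sub_comm])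

end VoidProbabilities

/-! ### Uniform asymptotic discernibility -/

section Asymptotic

variable {Ω : Type*} [MeasurableSpace Ω]

/-- Replaces bounds whose constants depend on the alternative by one common summable bound. -/
theorem eventually_mul_exp_le_one_div_sq (A : ℝ) {c : ℝ} (hc : 0 < c) :
    ∀ᶠ n : ℕ in atTop, A * Real.exp (-c * n) ≤ 1 / (n : ℝ) ^ 2 := by
  have hlin : Tendsto (fun n : ℕ => c * (n : ℝ)) atTop atTop :=
    tendsto_natCast_atTop_atTop.const_mul_atTop hc
  have h := ((Real.tendsto_pow_mul_exp_neg_atTop_nhds_zero 2).comp hlin).const_mul (A / c ^ 2)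
  rw [mul_zero] at h
  filter_upwards [h.eventually_le_const one_pos, eventually_gt_atTop 0] with n hn hn0
  have hn0' : (0 : ℝ) < n := by exact_mod_cast hn0
  rw [le_div_iff₀ (by positivity)]
  refine le_trans (le_of_eq ?_) hn
  simp only [Function.comp_apply, neg_mul]
  field_simp

/-- Tests for an increasing sequence of alternatives can be combined into a single sequence of
tests. -/
theorem exists_uniformlyDiscerns_of_monotone {Θ₀ : Set (FiniteMeasure Ω)}
    {Θ' : ℕ → Set (FiniteMeasure Ω)} (hmono : Monotone Θ')
    (h : ∀ k, ∃ (K : ∀ n, PoissonTest Ω n) (A c : ℝ), 0 < c ∧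
      HasErrorBound K (fun n => ENNReal.ofReal (A * Real.exp (-c * n))) Θ₀ (Θ' k)) :
    ∃ K : ∀ n, PoissonTest Ω n, ∀ k, UniformlyDiscerns K Θ₀ (Θ' k) := by
  choose K A c hc hK using h
  choose N hN using fun k => eventually_atTop.1 (eventually_mul_exp_le_one_div_sq (A k) (hc k))
  -- Sample size `n` uses the largest `k ≤ n` whose error bound has already dropped below `1 / n ^
  -- 2`. From `L` on, `s n ≥ j`, so `Θ' j ⊆ Θ' (s n)`; the finitely many earlier errors are bounded
  -- by `1`.
  set s : ℕ → ℕ := fun n => Nat.findGreatest (fun k => N k ≤ n) n with hs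
  refine ⟨fun n => K (s n) n, fun j => ?_⟩
  set L : ℕ := max (N 0) (max (N j) j) with hL
  set ε : ℕ → ℝ≥0∞ := fun n =>
    ENNReal.ofReal (1 / (n : ℝ) ^ 2) + if n ∈ Finset.range L then 1 else 0 with hε
  have hsum : ∑' n, ε n ≠ ⊤ := by
    rw [hε, ENNReal.tsum_add]
    refine ENNReal.add_ne_top.2 ⟨?_, ?_⟩
    · exact (Real.summable_one_div_nat_pow.2 one_lt_two).tsum_ofReal_ne_top
    · rw [tsum_eq_sum (s := Finset.range L) fun n hn => if_neg hn]
      exact ENNReal.sum_ne_top.2 fun n _ => by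
        split_ifs
        exact ENNReal.one_ne_top
  refine HasErrorBound.uniformlyDiscerns (ε := ε) ⟨fun n => (hK (s n)).nonrandomized n, ?_, ?_⟩ hsum
  · intro n μ hμ
    by_cases hn : n < L
    · refine prob_le_one.trans (le_add_left ?_)
      rw [if_pos (Finset.mem_range.2 hn)]
    · push Not at hn
      have hspec : N (s n) ≤ n :=
        Nat.findGreatest_spec (P := fun k => N k ≤ n) (Nat.zero_le n)
          ((le_max_left _ _).trans hn)
      exact ((hK (s n)).accepts n μ hμ).trans
        ((ENNReal.ofReal_le_ofReal (hN (s n) n hspec)).trans le_self_add)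
  · intro n μ hμ
    by_cases hn : n < L
    · refine prob_le_one.trans (le_add_left ?_)
      rw [if_pos (Finset.mem_range.2 hn)]
    · push Not at hn
      have hspec : N (s n) ≤ n :=
        Nat.findGreatest_spec (P := fun k => N k ≤ n) (Nat.zero_le n)
          ((le_max_left _ _).trans hn)
      have hj : j ≤ s n := Nat.le_findGreatest
        ((le_max_right _ _).trans ((le_max_right _ _).trans hn))
        ((le_max_left _ _).trans ((le_max_right _ _).trans hn))
      exact ((hK (s n)).rejects n μ (hmono hj hμ)).trans
        ((ENNReal.ofReal_le_ofReal (hN (s n) n hspec)).trans le_self_add)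

variable [TopologicalSpace Ω]

/-- Countably many bounded continuous functions determine a finite measure. -/
theorem exists_testAgainstNN_injective [BorelSpace Ω] [SecondCountableTopology Ω]
    [HasOuterApproxClosed Ω] :
    ∃ (ι : Type) (_ : Countable ι) (f : ι → BoundedContinuousFunction Ω ℝ≥0),
      Function.Injective fun (μ : FiniteMeasure Ω) i => μ.testAgainstNN (f i) := by
  -- Finite intersections of `b` form a countable π-system of open sets generating the Borel sets;
  -- `∅` is included because its complement gives the total mass.
  set b : Set (Set Ω) := insert ∅ (TopologicalSpace.countableBasis Ω) with hb
  have hbo : ∀ U ∈ b, IsOpen U := by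
    rintro U (rfl | hU)
    · exact isOpen_empty
    · exact TopologicalSpace.isOpen_of_mem_countableBasis hU
  set C : Set (Set Ω) := Set.sInter '' {s : Set (Set Ω) | s.Finite ∧ s ⊆ b} with hC
  have hCc : C.Countable :=
    (Set.countable_ofPred_finite_subset
      ((TopologicalSpace.countable_countableBasis Ω).insert ∅)).image _
  have hCo : ∀ U ∈ C, IsOpen U := by
    rintro _ ⟨s, ⟨hs, hsb⟩, rfl⟩
    exact hs.isOpen_sInter fun U hU => hbo U (hsb hU)
  have hbC : b ⊆ C := fun U hU => ⟨{U}, ⟨Set.finite_singleton U, by simpa using hU⟩, by simp⟩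
  have hCpi : IsPiSystem C := by
    rintro _ ⟨s, ⟨hs, hsb⟩, rfl⟩ _ ⟨u, ⟨hu, hub⟩, rfl⟩ -
    exact ⟨s ∪ u, ⟨hs.union hu, Set.union_subset hsb hub⟩, Set.sInter_union s u⟩
  have hgen : ‹MeasurableSpace Ω› = MeasurableSpace.generateFrom C := by
    refine le_antisymm ?_ (MeasurableSpace.generateFrom_le fun U hU => (hCo U hU).measurableSet)
    rw [BorelSpace.measurable_eq (α := Ω),
      (TopologicalSpace.isBasis_countableBasis Ω).borel_eq_generateFrom]
    exact MeasurableSpace.generateFrom_mono ((Set.subset_insert _ _).trans hbC)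
  obtain ⟨U, hU⟩ := hCc.exists_eq_range ⟨∅, hbC (Set.mem_insert _ _)⟩
  have hUo : ∀ n, IsOpen (U n) := fun n => hCo _ (hU ▸ Set.mem_range_self n)
  refine ⟨ℕ × ℕ, inferInstance, fun p => (hUo p.1).isClosed_compl.apprSeq p.2, fun μ ν h => ?_⟩
  have hlint : ∀ n k, ∫⁻ x, (hUo n).isClosed_compl.apprSeq k x ∂(μ : Measure Ω) =
      ∫⁻ x, (hUo n).isClosed_compl.apprSeq k x ∂(ν : Measure Ω) := fun n k => by
    rw [← FiniteMeasure.testAgainstNN_coe_eq, ← FiniteMeasure.testAgainstNN_coe_eq]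
    exact congrArg _ (congrFun h (n, k))
  have hcompl : ∀ V ∈ C, (μ : Measure Ω) Vᶜ = (ν : Measure Ω) Vᶜ := by
    intro V hV
    obtain ⟨n, rfl⟩ : V ∈ Set.range U := hU ▸ hV
    refine tendsto_nhds_unique
      (HasOuterApproxClosed.tendsto_lintegral_apprSeq (hUo n).isClosed_compl (μ : Measure Ω)) ?_
    simp_rw [hlint]
    exact HasOuterApproxClosed.tendsto_lintegral_apprSeq (hUo n).isClosed_compl (ν : Measure Ω)
  have huniv : (μ : Measure Ω) Set.univ = (ν : Measure Ω) Set.univ := by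
    simpa using hcompl ∅ (hbC (Set.mem_insert _ _))
  refine FiniteMeasure.toMeasure_injective (ext_of_generate_finite C hgen hCpi (fun V hV => ?_) huniv)
  have hVm := (hCo V hV).measurableSet
  rw [← compl_compl V, measure_compl hVm.compl (measure_ne_top _ _),
    measure_compl hVm.compl (measure_ne_top _ _)]
  exact congrArg₂ _ huniv (hcompl V hV)

/-- The complement of a compact set of finite measures is a countable increasing union of closed
sets. -/
theorem exists_isClosed_monotone_iUnion_eq_compl [BorelSpace Ω] [SecondCountableTopology Ω]
    [HasOuterApproxClosed Ω] {S : Set (FiniteMeasure Ω)} (hS : IsCompact S) :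
    ∃ Θ' : ℕ → Set (FiniteMeasure Ω), Monotone Θ' ∧ (∀ k, IsClosed (Θ' k)) ∧ ⋃ k, Θ' k = Sᶜ := by
  obtain ⟨ι, _, f, hf⟩ := exists_testAgainstNN_injective (Ω := Ω)
  let _ : MetricSpace (ι → ℝ≥0) := TopologicalSpace.metrizableSpaceMetric _
  set F : FiniteMeasure Ω → ι → ℝ≥0 := fun μ i => μ.testAgainstNN (f i) with hF
  have hFc : Continuous F :=
    continuous_pi fun i => FiniteMeasure.continuous_testAgainstNN_eval (f i)
  have hFS : IsClosed (F '' S) := (hS.image hFc).isClosed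
  -- By injectivity `F μ` avoids the closed set `F '' S` exactly when `μ ∉ S`. The extended distance
  -- to the empty set is `⊤`, so `S = ∅` needs no separate case.
  refine ⟨fun k => {μ | ((k : ℝ≥0∞) + 1)⁻¹ ≤ Metric.infEDist (F μ) (F '' S)}, ?_, ?_, ?_⟩
  · intro i j hij μ (hμ : ((i : ℝ≥0∞) + 1)⁻¹ ≤ Metric.infEDist (F μ) (F '' S))
    refine le_trans ?_ hμ
    gcongr
  · exact fun k => isClosed_le continuous_const (Metric.continuous_infEDist.comp hFc)
  · ext μ
    simp only [Set.mem_iUnion, Set.mem_ofPred_eq, Set.mem_compl_iff]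
    constructor
    · rintro ⟨k, hk⟩ hμ
      rw [Metric.infEDist_zero_of_mem (Set.mem_image_of_mem F hμ)] at hk
      simp at hk
    · intro hμ
      have hpos : 0 < Metric.infEDist (F μ) (F '' S) := by
        rw [Metric.infEDist_pos_iff_notMem_closure, hFS.closure_eq, hf.mem_set_image]
        exact hμ
      obtain ⟨n, hn⟩ := ENNReal.exists_inv_nat_lt hpos.ne'
      exact ⟨n, (ENNReal.inv_le_inv.2 le_self_add).trans hn.le⟩

theorem WeaklyRelativelyCompact.uniformlyAsymptoticallyDiscernible [BorelSpace Ω]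
    [SecondCountableTopology Ω] [HasOuterApproxClosed Ω] {Θ₀ : Set (FiniteMeasure Ω)}
    (h : WeaklyRelativelyCompact Θ₀) : UniformlyAsymptoticallyDiscernible Θ₀ := by
  obtain ⟨Θ', hmono, hclosed, hunion⟩ := exists_isClosed_monotone_iUnion_eq_compl h
  obtain ⟨K, hK⟩ := exists_uniformlyDiscerns_of_monotone hmono fun k =>
    exists_hasErrorBound_of_weaklyRelativelyCompact (Or.inl h) (by
      rw [(hclosed k).closure_eq, Set.inter_comm, ← Set.disjoint_iff_inter_eq_empty]
      exact Set.disjoint_left.2 fun μ hμ hμ' =>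
        (hunion ▸ Set.mem_iUnion_of_mem k hμ : μ ∈ (closure Θ₀)ᶜ) hμ')
  exact ⟨Θ', K, fun k => hmono k.le_succ, by rw [hunion, Set.compl_union_self], hK⟩

end Asymptotic

end PoissonTesting

end

theorem theorem2p10 (Ω : Type*) [TopologicalSpace Ω] [T2Space Ω] [MeasurableSpace Ω]
    [BorelSpace Ω] :
    (∀ Θ₀ Θ₁ : Set (FiniteMeasure Ω), PoissonTesting.Distinguishable Θ₀ Θ₁ →
      PoissonTesting.UniformlyDiscernible Θ₀ Θ₁ ∧
        PoissonTesting.UniformlyDiscernibleExpMoment Θ₀ Θ₁) ∧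
    (PolishSpace Ω →
      (∀ Θ₀ Θ₁ : Set (FiniteMeasure Ω),
        PoissonTesting.TauRelativelyCompact Θ₀ → PoissonTesting.TauRelativelyCompact Θ₁ →
        (closure Θ₀ ∩ closure Θ₁).Nonempty → PoissonTesting.Indistinguishable Θ₀ Θ₁) ∧
      (∀ Θ₀ Θ₁ : Set (FiniteMeasure Ω),
        PoissonTesting.WeaklyRelativelyCompact Θ₀ ∨ PoissonTesting.WeaklyRelativelyCompact Θ₁ →
        closure Θ₀ ∩ closure Θ₁ = ∅ →
        PoissonTesting.Distinguishable Θ₀ Θ₁ ∧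
          PoissonTesting.ExponentiallyDistinguishable Θ₀ Θ₁) ∧
      (∀ Θ₀ Θ₁ : Set (FiniteMeasure Ω),
        PoissonTesting.WeaklyRelativelyCompact Θ₀ ∨ PoissonTesting.WeaklyRelativelyCompact Θ₁ →
        closure Θ₀ ∩ closure Θ₁ = ∅ →
        ∃ (k : ℕ) (B : Fin k → Set Ω), (∀ i, IsOpen (B i)) ∧
          closure (PoissonTesting.valueSet B Θ₀) ∩ closure (PoissonTesting.valueSet B Θ₁) = ∅) ∧
      (∀ Θ₀ : Set (FiniteMeasure Ω), PoissonTesting.WeaklyRelativelyCompact Θ₀ →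
        PoissonTesting.UniformlyAsymptoticallyDiscernible Θ₀)) := by
  refine ⟨fun Θ₀ Θ₁ h => ?_, fun _ => ⟨fun Θ₀ Θ₁ h₀ h₁ h => ?_, fun Θ₀ Θ₁ hc hd => ?_,
    fun Θ₀ Θ₁ hc hd => ?_, fun Θ₀ hc => ?_⟩⟩
  · obtain ⟨K, A, c, hc, hK⟩ := h.exists_hasErrorBound
    exact ⟨⟨K, hK.uniformlyDiscerns (PoissonTesting.tsum_ofReal_mul_exp_ne_top A hc)⟩,
      hK.uniformlyDiscernibleExpMoment hc⟩
  · exact PoissonTesting.indistinguishable_of_inter_closure_nonempty h₀ h₁ h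
  · obtain ⟨K, A, c, hc, hK⟩ :=
      PoissonTesting.exists_hasErrorBound_of_weaklyRelativelyCompact hc hd
    have := hK.exponentiallyDistinguishable hc
    exact ⟨this.distinguishable, this⟩
  · exact PoissonTesting.exists_isOpen_inter_closure_valueSet_eq_empty hc hd
  · exact hc.uniformlyAsymptoticallyDiscernible
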